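/- Let $\mathbb{C}(v)$ be the field of rational functions in an indeterminate $v$, and let $[2]=v+v^{-1}$. Let $MU_v(2)$ be the unital associative $\mathbb{C}(v)$-algebra with generators $e,f,k,k^{-1},\ell$ and relations $$kk^{-1}=k^{-1}k=1,\quad kek^{-1}=v^2e,\quad kfk^{-1}=v^{-2}f,\quad ef-fe=\frac{k-k^{-1}}{v-v^{-1}},$$ $$\ell^2=\ell,\quad k\ell=\ell k,\quad \ell e\ell=\ell e,\quad \ell f\ell=f\ell,$$ $$[2]\,e\ell e=v^{-1}e^2\ell+v\,\ell e^2,\qquad [2]\,f\ell f=v^{-1}\ell f^2+v f^2\ell.$$ Consider the six families of monomials in $MU_v(2)$ $$\mathcal B_0=\{f^re^sk^t : r,s\ge 0,\ t\in\mathbb Z\},\qquad \mathcal B_1=\{\ell f^re^sk^t : r,s\ge 0,\ t\in\mathbb Z\},$$ $$\mathcal B_2=\{f^re^s\ell k^t : r,s\ge 0,\ (r,s)\ne(0,0),\ t\in\mathbb Z\},\qquad \mathcal B_3=\{\ell f^re^s\ell k^t : r,s\ge 1,\ t\in\mathbb Z\},$$ $$\mathcal B_4=\{f^r\ell e^sk^t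 : r,s\ge 1,\ t\in\mathbb Z\},\qquad \mathcal B_5=\{e^s\ell f^rk^t : r,s\ge 1,\ t\in\mathbb Z\}.$$ Then the listed monomials are pairwise distinct (both within each family and between families), and the set $\mathcal B=\bigsqcup_{i=0}^5\mathcal B_i$ is linearly independent over $\mathbb C(v)$ and spans $MU_v(2)$; that is, $\mathcal B$ is a basis of $MU_v(2)$ over $\mathbb C(v)$. -/

import Mathlib

namespace MirabolicSl2

/-- The field `ℂ(v)` of rational functions in one indeterminate over `ℂ`. -/
abbrev Cv : Type := RatFunc ℂ

/-- The indeterminate `v` of `ℂ(v)`. -/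
noncomputable def v : Cv := RatFunc.X

/-- The symmetric quantum integer `[m] = (v^m - v^(-m)) / (v - v⁻¹)`. -/
noncomputable def qInt (m : ℕ) : Cv := (v ^ m - v⁻¹ ^ m) / (v - v⁻¹)

/-- The Chevalley generators `e, f, k, k⁻¹, ℓ`. -/
inductive Gen : Type
  | e | f | k | kInv | l

/-- The free unital associative `ℂ(v)`-algebra on the Chevalley generators. -/
abbrev Free : Type := FreeAlgebra Cv Gen

namespace Free

noncomputable def e : Free := FreeAlgebra.ι Cv Gen.e
noncomputable def f : Free := FreeAlgebra.ι Cv Gen.f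
noncomputable def k : Free := FreeAlgebra.ι Cv Gen.k
noncomputable def kInv : Free := FreeAlgebra.ι Cv Gen.kInv
noncomputable def l : Free := FreeAlgebra.ι Cv Gen.l

end Free

open Free in
/-- The defining relations of mirabolic quantum `sl₂`. -/
inductive Rel : Free → Free → Prop
  | k_mul_kInv : Rel (k * kInv) 1
  | kInv_mul_k : Rel (kInv * k) 1
  | k_e : Rel (k * e * kInv) (v ^ 2 • e)
  | k_f : Rel (k * f * kInv) (v⁻¹ ^ 2 • f)
  | e_f : Rel (e * f - f * e) ((v - v⁻¹)⁻¹ • (k - kInv))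
  | l_sq : Rel (l ^ 2) l
  | k_l : Rel (k * l) (l * k)
  | l_e_l : Rel (l * e * l) (l * e)
  | l_f_l : Rel (l * f * l) (f * l)
  | e_l_e : Rel (qInt 2 • (e * l * e)) (v⁻¹ • (e ^ 2 * l) + v • (l * e ^ 2))
  | f_l_f : Rel (qInt 2 • (f * l * f)) (v⁻¹ • (l * f ^ 2) + v • (f ^ 2 * l))

/-- Mirabolic quantum `sl₂`: the unital `ℂ(v)`-algebra presented by the generators
`e, f, k, k⁻¹, ℓ` and the relations `Rel`. -/
def MU : Type := RingQuot Rel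

noncomputable instance : Ring MU := inferInstanceAs (Ring (RingQuot Rel))

noncomputable instance : Algebra Cv MU := inferInstanceAs (Algebra Cv (RingQuot Rel))

namespace MU

/-- The quotient map from the free algebra. -/
noncomputable def mk : Free →ₐ[Cv] MU := RingQuot.mkAlgHom Cv Rel

theorem mk_eq {a b : Free} (h : Rel a b) : mk a = mk b := RingQuot.mkAlgHom_rel Cv h

noncomputable def e : MU := mk Free.e
noncomputable def f : MU := mk Free.f
noncomputable def l : MU := mk Free.l

/-- The generator `k` as a unit with inverse the generator `k⁻¹`, so that `k ^ t` makes sense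
for every integer `t`. -/
noncomputable def k : MUˣ where
  val := mk Free.k
  inv := mk Free.kInv
  val_inv := by rw [← map_mul, mk_eq Rel.k_mul_kInv, map_one]
  inv_val := by rw [← map_mul, mk_eq Rel.kInv_mul_k, map_one]

end MU

/-- Index set of the PBW monomials: the disjoint union of the index sets of the six families. -/
inductive PBWIndex : Type
  | B₀ (r s : ℕ) (t : ℤ)
  | B₁ (r s : ℕ) (t : ℤ)
  | B₂ (r s : ℕ) (t : ℤ) (h : (r, s) ≠ (0, 0))
  | B₃ (r s : ℕ) (t : ℤ) (hr : 1 ≤ r) (hs : 1 ≤ s)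
  | B₄ (r s : ℕ) (t : ℤ) (hr : 1 ≤ r) (hs : 1 ≤ s)
  | B₅ (r s : ℕ) (t : ℤ) (hr : 1 ≤ r) (hs : 1 ≤ s)

open MU in
/-- The PBW monomials. -/
noncomputable def pbw : PBWIndex → MU
  | .B₀ r s t => f ^ r * e ^ s * (k ^ t : MUˣ)
  | .B₁ r s t => l * f ^ r * e ^ s * (k ^ t : MUˣ)
  | .B₂ r s t _ => f ^ r * e ^ s * l * (k ^ t : MUˣ)
  | .B₃ r s t _ _ => l * f ^ r * e ^ s * l * (k ^ t : MUˣ)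
  | .B₄ r s t _ _ => f ^ r * l * e ^ s * (k ^ t : MUˣ)
  | .B₅ r s t _ _ => e ^ s * l * f ^ r * (k ^ t : MUˣ)

end MirabolicSl2

/-!
Let `p = l` and `q = 1 - l`. In the Peirce decomposition of `MU` for these idempotents the
relations `lel = le` and `lfl = fl` make `e` lower and `f` upper triangular,
`e = [[a, 0], [x, b]]` and `f = [[c, y], [0, d]]`, and the cubic relations become
`bx = v²xa` and `yd = v²cy`, equivalently `e[e, l] = v²[e, l]e` and `f[f, l] = v⁻²[f, l]f`
(`e_mul_commutator`, `f_mul_commutator`). It follows that `v·yx·k` is a central idempotent of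
`p MU p`, so that `MU` is a product of two copies of quantum `sl₂` (with `l` acting as `0` and
as `1`) and a `2 × 2` matrix algebra over quantum `sl₂`. Only the resulting homomorphisms are
used, not the isomorphism itself.

Spanning. By the commutator identities `[eⁿ, l]` is a nonzero multiple of `[e, l]eⁿ⁻¹`
(`commutator_pow`), hence `e l eⁿ` is a combination of `eⁿ⁺¹ l` and `l eⁿ⁺¹`, and similarly for
`f`. The subalgebra `U` generated by `e, f, k, k⁻¹` is spanned by the monomials `fʳeˢkᵗ`, and also
by the `eˢfʳkᵗ` (`adjoin_le_span`). With both orders available, the span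
`U + lU + Ul + lUl + ∑ fʳleˢkᵗ + ∑ eˢlfʳkᵗ` of the PBW monomials is stable under left
multiplication by every generator.

Independence. Quantum `sl₂` acts on a weight module indexed by `ℤ` with a free weight parameter and
a free Casimir parameter; applied to one weight vector, the monomial `fʳeˢkᵗ` gives `λᵗ` times a
polynomial in the Casimir parameter which is monic of degree `s`, in weight `r - s`. Such vectors
are linearly independent (`linearIndependent_of_monic`). In the two scalar representations and the
`2 × 2` matrix representation over these operators, the components, taken in a
suitable order, isolate the coefficients family by family
(`IsTwistedTriple.linearIndependent_pbw`). The families `B₃` and `B₄` are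
separated by the term of `l fʳ eˢ l` that passes through the second block.
-/

open scoped Polynomial

namespace MirabolicSl2

/-! ### The scalars -/

theorem v_ne_zero : v ≠ 0 := RatFunc.X_ne_zero

theorem v_pow_ne_one {n : ℕ} (hn : n ≠ 0) : v ^ n ≠ 1 := by
  intro h
  have h1 : algebraMap ℂ[X] Cv (Polynomial.X ^ n) = algebraMap ℂ[X] Cv 1 := by
    rw [map_pow, RatFunc.algebraMap_X, map_one]; exact h
  have h2 := congrArg Polynomial.natDegree (RatFunc.algebraMap_injective ℂ h1)
  rw [Polynomial.natDegree_X_pow, Polynomial.natDegree_one] at h2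
  exact hn h2

theorem v_sub_inv_ne_zero : v - v⁻¹ ≠ 0 := by
  intro h
  refine v_pow_ne_one two_ne_zero ?_
  have h1 := v_ne_zero
  field_simp at h
  linear_combination h

theorem qInt_two : qInt 2 = v + v⁻¹ := by
  have h := v_sub_inv_ne_zero
  rw [qInt, div_eq_iff h]
  ring

theorem geom_sum_ne_zero {q : Cv} (hq : ∀ n : ℕ, n ≠ 0 → q ^ n ≠ 1) (n : ℕ) :
    ∑ i ∈ Finset.range (n + 1), q ^ i ≠ 0 := by
  intro h
  have h1 := geom_sum_mul q (n + 1)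
  rw [h, zero_mul] at h1
  exact hq (n + 1) n.succ_ne_zero (sub_eq_zero.mp h1.symm)

theorem v_sq_pow_ne_one (n : ℕ) (hn : n ≠ 0) : (v ^ 2) ^ n ≠ 1 := by
  rw [← pow_mul]
  exact v_pow_ne_one (mul_ne_zero two_ne_zero hn)

theorem v_inv_sq_pow_ne_one (n : ℕ) (hn : n ≠ 0) : (v⁻¹ ^ 2) ^ n ≠ 1 := by
  rw [inv_pow, inv_pow, Ne, inv_eq_one]
  exact v_sq_pow_ne_one n hn

/-! ### Elements commuting up to a scalar -/

section Generic

variable {A : Type*} [Ring A] [Algebra Cv A]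

theorem zpow_mul_of_mul {k : Aˣ} {x : A} {q : Cv} (hq : q ≠ 0)
    (h : (k : A) * x = q • (x * k)) (j : ℤ) :
    ((k ^ j : Aˣ) : A) * x = q ^ j • (x * (k ^ j : Aˣ)) := by
  have hinv : ((k⁻¹ : Aˣ) : A) * x = q⁻¹ • (x * (k⁻¹ : Aˣ)) := by
    rw [Units.inv_mul_eq_iff_eq_mul, mul_smul_comm, ← mul_assoc, h, smul_mul_assoc,
      inv_smul_smul₀ hq, Units.mul_inv_cancel_right]
  induction j using Int.induction_on with
  | zero => simp
  | succ i ih =>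
    rw [zpow_add_one, Units.val_mul, mul_assoc, h, mul_smul_comm, ← mul_assoc, ih, smul_mul_assoc,
      smul_smul, mul_assoc, zpow_add_one₀ hq, mul_comm q]
  | pred i ih =>
    rw [zpow_sub_one, Units.val_mul, mul_assoc, hinv, mul_smul_comm, ← mul_assoc, ih,
      smul_mul_assoc, smul_smul, mul_assoc, zpow_sub_one₀ hq, mul_comm q⁻¹]

theorem mul_pow_of_mul {k x : A} {q : Cv} (h : k * x = q • (x * k)) (n : ℕ) :
    k * x ^ n = q ^ n • (x ^ n * k) := by
  induction n with
  | zero => simp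
  | succ n ih =>
    rw [pow_succ, ← mul_assoc, ih, smul_mul_assoc, mul_assoc, h, mul_smul_comm, smul_smul,
      ← mul_assoc, pow_succ]

/-- If `D = xl - lx` satisfies `xD = q Dx`, then `[xⁿ⁺¹, l]` telescopes to a multiple of `D xⁿ`. -/
theorem commutator_pow {x l : A} {q : Cv}
    (h : x * (x * l - l * x) = q • ((x * l - l * x) * x)) (n : ℕ) :
    x ^ (n + 1) * l - l * x ^ (n + 1) =
      (∑ i ∈ Finset.range (n + 1), q ^ i) • ((x * l - l * x) * x ^ n) := by
  induction n with
  | zero => simp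
  | succ n ih =>
    have h1 : x ^ (n + 1 + 1) * l - l * x ^ (n + 1 + 1) =
        x * (x ^ (n + 1) * l - l * x ^ (n + 1)) + (x * l - l * x) * x ^ (n + 1) := by
      rw [pow_succ' x (n + 1)]; noncomm_ring
    rw [h1, ih, geom_sum_succ (n := n + 1), mul_smul_comm, ← mul_assoc, h, smul_mul_assoc,
      mul_assoc, ← pow_succ', smul_smul, add_smul, one_smul, mul_comm q]

theorem mul_mul_pow_mem {x l : A} {q : Cv} (hq : ∀ n : ℕ, n ≠ 0 → q ^ n ≠ 1)
    (h : x * (x * l - l * x) = q • ((x * l - l * x) * x)) (n : ℕ) :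
    ∃ α β : Cv, x * l * x ^ n = α • (x ^ (n + 1) * l) + β • (l * x ^ (n + 1)) := by
  have h1 := commutator_pow h n
  have h0 := geom_sum_ne_zero hq n
  set σ := ∑ i ∈ Finset.range (n + 1), q ^ i
  refine ⟨σ⁻¹, 1 - σ⁻¹, ?_⟩
  have h2 : (x * l - l * x) * x ^ n = σ⁻¹ • (x ^ (n + 1) * l - l * x ^ (n + 1)) := by
    rw [h1, inv_smul_smul₀ h0]
  rw [sub_mul, smul_sub, mul_assoc l, ← pow_succ', sub_eq_iff_eq_add] at h2
  rw [h2, sub_smul, one_smul]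
  abel

theorem mul_pow_eq_of_commutator {a b : A} {k : Aˣ} {q α β : Cv} (hq : q ≠ 0)
    (hb : (k : A) * b = q • (b * k))
    (hab : a * b - b * a = α • (k : A) + β • ((k⁻¹ : Aˣ) : A)) (n : ℕ) :
    ∃ α' β' : Cv, a * b ^ (n + 1) = b ^ (n + 1) * a +
      (α' • (b ^ n * k) + β' • (b ^ n * (k⁻¹ : Aˣ))) := by
  have hb' := zpow_mul_of_mul hq hb (-1)
  rw [zpow_neg_one] at hb'
  induction n with
  | zero =>
    refine ⟨α, β, ?_⟩
    rw [zero_add, pow_one, pow_zero, one_mul, one_mul, ← hab]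
    abel
  | succ n ih =>
    obtain ⟨α', β', h⟩ := ih
    refine ⟨α + α' * q, β + β' * q ^ (-1 : ℤ), ?_⟩
    rw [pow_succ b (n + 1), ← mul_assoc, h, add_mul, add_mul, mul_assoc _ a b,
      eq_add_of_sub_eq' hab]
    simp only [smul_mul_assoc, mul_assoc, hb, hb', mul_smul_comm, mul_add, smul_smul, add_smul]
    simp only [← mul_assoc, ← pow_succ]
    abel

theorem mul_mem_of_mem_span {s : Set A} {N : Submodule Cv A} {x n : A}
    (hn : n ∈ Submodule.span Cv s) (h : ∀ y ∈ s, x * y ∈ N) : x * n ∈ N :=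
  Submodule.span_le (p := N.comap (LinearMap.mulLeft Cv x)).mpr h hn

/-- A left ideal criterion: a submodule which contains `1` and is stable under left multiplication
by `s` contains the subalgebra generated by `s`. -/
theorem adjoin_le_of_mul_mem {s : Set A} {N : Submodule Cv A} (h1 : 1 ∈ N)
    (hs : ∀ x ∈ s, ∀ n ∈ N, x * n ∈ N) {x : A} (hx : x ∈ Algebra.adjoin Cv s) : x ∈ N := by
  suffices h : ∀ n ∈ N, x * n ∈ N by simpa using h 1 h1
  induction hx using Algebra.adjoin_induction with
  | mem x hx => exact hs x hx
  | algebraMap r => intro n hn; rw [← Algebra.smul_def]; exact N.smul_mem r hn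
  | add x y _ _ ihx ihy => intro n hn; rw [add_mul]; exact N.add_mem (ihx n hn) (ihy n hn)
  | mul x y _ _ ihx ihy => intro n hn; rw [mul_assoc]; exact ihx _ (ihy n hn)

/-- The spanning half of the PBW theorem for an algebra of quantum `sl₂` type. It is applied to
both orders of the Chevalley generators. -/
theorem adjoin_le_span {a b : A} {k : Aˣ} {p q α β : Cv} (hp : p ≠ 0) (hq : q ≠ 0)
    (ha : (k : A) * a = p • (a * k)) (hb : (k : A) * b = q • (b * k))
    (hab : a * b - b * a = α • (k : A) + β • ((k⁻¹ : Aˣ) : A)) {x : A}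
    (hx : x ∈ Algebra.adjoin Cv {a, b, (k : A), ((k⁻¹ : Aˣ) : A)}) :
    x ∈ Submodule.span Cv
      (Set.range fun i : ℕ × ℕ × ℤ ↦ b ^ i.1 * a ^ i.2.1 * (k ^ i.2.2 : Aˣ)) := by
  set N := Submodule.span Cv
    (Set.range fun i : ℕ × ℕ × ℤ ↦ b ^ i.1 * a ^ i.2.1 * (k ^ i.2.2 : Aˣ)) with hN
  have hmem : ∀ (r s : ℕ) (t : ℤ), b ^ r * a ^ s * (k ^ t : Aˣ) ∈ N := fun r s t ↦
    Submodule.subset_span ⟨(r, s, t), rfl⟩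
  have hk : ∀ (j : ℤ) (r s : ℕ) (t : ℤ), b ^ r * ((k ^ j : Aˣ) : A) * a ^ s * (k ^ t : Aˣ) ∈ N := by
    intro j r s t
    rw [mul_assoc (b ^ r), mul_pow_of_mul (zpow_mul_of_mul hp ha j) s, mul_smul_comm,
      smul_mul_assoc, ← mul_assoc, mul_assoc _ _ ((k ^ t : Aˣ) : A), ← Units.val_mul, ← zpow_add]
    exact N.smul_mem _ (hmem _ _ _)
  have hkN : ∀ j : ℤ, ∀ n ∈ N, ((k ^ j : Aˣ) : A) * n ∈ N := by
    intro j n hn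
    refine mul_mem_of_mem_span hn ?_
    rintro _ ⟨⟨r, s, t⟩, rfl⟩
    simp only
    rw [← mul_assoc, ← mul_assoc, mul_pow_of_mul (zpow_mul_of_mul hq hb j) r, smul_mul_assoc,
      smul_mul_assoc]
    exact N.smul_mem _ (hk _ _ _ _)
  refine adjoin_le_of_mul_mem (by simpa using hmem 0 0 0) ?_ hx
  rintro y (rfl | rfl | rfl | rfl) n hn
  · refine mul_mem_of_mem_span hn ?_
    rintro _ ⟨⟨r, s, t⟩, rfl⟩
    simp only
    cases r with
    | zero => simpa [pow_succ', mul_assoc] using hmem 0 (s + 1) t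
    | succ r =>
      obtain ⟨α', β', h⟩ := mul_pow_eq_of_commutator hq hb hab r
      rw [← mul_assoc, ← mul_assoc, h]
      simp only [add_mul, smul_mul_assoc]
      refine N.add_mem ?_ (N.add_mem (N.smul_mem _ ?_) (N.smul_mem _ ?_))
      · rw [mul_assoc _ y, ← pow_succ']; exact hmem _ _ _
      · simpa using hk 1 r s t
      · simpa using hk (-1) r s t
  · refine mul_mem_of_mem_span hn ?_
    rintro _ ⟨⟨r, s, t⟩, rfl⟩
    simpa [pow_succ', mul_assoc] using hmem (r + 1) s t
  · simpa using hkN 1 n hn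
  · simpa using hkN (-1) n hn

end Generic

namespace MU

/-! ### Relations in `MU` -/

theorem k_val : (k : MU) = mk Free.k := rfl

theorem k_inv_val : ((k⁻¹ : MUˣ) : MU) = mk Free.kInv := rfl

theorem k_mul_e : (k : MU) * e = v ^ 2 • (e * k) := by
  have h := mk_eq Rel.k_e
  rw [map_mul, map_mul, map_smul, ← k_val, ← k_inv_val] at h
  have h2 : (k : MU) * e * (k⁻¹ : MUˣ) = v ^ 2 • e := h
  rw [← smul_mul_assoc, ← h2, Units.inv_mul_cancel_right]

theorem k_mul_f : (k : MU) * f = v⁻¹ ^ 2 • (f * k) := by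
  have h := mk_eq Rel.k_f
  rw [map_mul, map_mul, map_smul, ← k_val, ← k_inv_val] at h
  have h2 : (k : MU) * f * (k⁻¹ : MUˣ) = v⁻¹ ^ 2 • f := h
  rw [← smul_mul_assoc, ← h2, Units.inv_mul_cancel_right]

theorem e_mul_f : e * f - f * e =
    (v - v⁻¹)⁻¹ • (k : MU) + (-(v - v⁻¹)⁻¹) • ((k⁻¹ : MUˣ) : MU) := by
  have h := mk_eq Rel.e_f
  rw [map_sub, map_mul, map_mul, map_smul, map_sub, ← k_val, ← k_inv_val, smul_sub] at h
  rw [neg_smul, ← sub_eq_add_neg]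
  exact h

theorem f_mul_e : f * e - e * f =
    (-(v - v⁻¹)⁻¹) • (k : MU) + (v - v⁻¹)⁻¹ • ((k⁻¹ : MUˣ) : MU) := by
  rw [← neg_sub, e_mul_f, neg_add, ← neg_smul, ← neg_smul, neg_neg]

theorem l_mul_l : l * l = l := by
  have h := mk_eq Rel.l_sq
  rw [pow_two, map_mul] at h
  exact h

theorem k_mul_l : (k : MU) * l = l * k := by
  have h := mk_eq Rel.k_l
  rw [map_mul, map_mul] at h
  exact h

theorem l_mul_e_mul_l : l * e * l = l * e := by
  have h := mk_eq Rel.l_e_l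
  rw [map_mul, map_mul] at h
  exact h

theorem l_mul_f_mul_l : l * f * l = f * l := by
  have h := mk_eq Rel.l_f_l
  rw [map_mul, map_mul, map_mul] at h
  exact h

/-- The first cubic relation says that `[e, l]` commutes with `e` up to the scalar `v²`. -/
theorem e_mul_commutator : e * (e * l - l * e) = v ^ 2 • ((e * l - l * e) * e) := by
  have h := mk_eq Rel.e_l_e
  simp only [map_add, map_smul, map_mul, pow_two, qInt_two] at h
  replace h : (v + v⁻¹) • (e * l * e) = v⁻¹ • (e * e * l) + v • (l * (e * e)) := h
  have h3 := congrArg (v • ·) h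
  simp only [smul_add, smul_smul, mul_inv_cancel₀ v_ne_zero, one_smul, add_smul] at h3
  rw [mul_sub, sub_mul, smul_sub, pow_two, ← mul_assoc, ← mul_assoc, mul_assoc l,
    sub_eq_sub_iff_add_eq_add, ← h3]

/-- The second cubic relation says that `[f, l]` commutes with `f` up to the scalar `v⁻²`. -/
theorem f_mul_commutator : f * (f * l - l * f) = v⁻¹ ^ 2 • ((f * l - l * f) * f) := by
  have h := mk_eq Rel.f_l_f
  simp only [map_add, map_smul, map_mul, pow_two, qInt_two] at h
  replace h : (v + v⁻¹) • (f * l * f) = v⁻¹ • (l * (f * f)) + v • (f * f * l) := h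
  have h3 := congrArg (v⁻¹ • ·) h
  simp only [smul_add, smul_smul, inv_mul_cancel₀ v_ne_zero, one_smul, add_smul] at h3
  rw [mul_sub, sub_mul, smul_sub, pow_two, ← mul_assoc, ← mul_assoc, mul_assoc l]
  rw [sub_eq_sub_iff_add_eq_add, add_comm (f * f * l), ← h3]
  abel

theorem l_mul_e_pow_mul_l (n : ℕ) : l * e ^ n * l = l * e ^ n := by
  induction n with
  | zero => rw [pow_zero, mul_one, l_mul_l]
  | succ n ih =>
    rw [pow_succ', ← mul_assoc, ← l_mul_e_mul_l, mul_assoc (l * e), mul_assoc (l * e), ih]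

theorem l_mul_f_pow_mul_l (n : ℕ) : l * f ^ n * l = f ^ n * l := by
  induction n with
  | zero => rw [pow_zero, mul_one, one_mul, l_mul_l]
  | succ n ih =>
    rw [pow_succ, mul_assoc, mul_assoc, ← l_mul_f_mul_l, mul_assoc l f l, ← mul_assoc (f ^ n),
      ← mul_assoc l, ← mul_assoc l, ih, mul_assoc]

theorem e_mul_l_mul_e_pow (n : ℕ) :
    ∃ α β : Cv, e * l * e ^ n = α • (e ^ (n + 1) * l) + β • (l * e ^ (n + 1)) :=
  mul_mul_pow_mem v_sq_pow_ne_one e_mul_commutator n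

theorem f_mul_l_mul_f_pow (n : ℕ) :
    ∃ α β : Cv, f * l * f ^ n = α • (f ^ (n + 1) * l) + β • (l * f ^ (n + 1)) :=
  mul_mul_pow_mem v_inv_sq_pow_ne_one f_mul_commutator n

theorem e_mul_f_pow (n : ℕ) : ∃ α β : Cv, e * f ^ (n + 1) = f ^ (n + 1) * e +
    (α • (f ^ n * (k : MU)) + β • (f ^ n * (k⁻¹ : MUˣ))) :=
  mul_pow_eq_of_commutator (pow_ne_zero 2 (inv_ne_zero v_ne_zero)) k_mul_f e_mul_f n

theorem f_mul_e_pow (n : ℕ) : ∃ α β : Cv, f * e ^ (n + 1) = e ^ (n + 1) * f +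
    (α • (e ^ n * (k : MU)) + β • (e ^ n * (k⁻¹ : MUˣ))) :=
  mul_pow_eq_of_commutator (pow_ne_zero 2 v_ne_zero) k_mul_e f_mul_e n

/-! ### The monomials span -/

/-- The span of the PBW monomials. -/
noncomputable def pbwSpan : Submodule Cv MU := Submodule.span Cv (Set.range pbw)

theorem k_zpow_mul_l (j : ℤ) : ((k ^ j : MUˣ) : MU) * l = l * (k ^ j : MUˣ) := by
  simpa using zpow_mul_of_mul (k := k) (x := l) one_ne_zero (by rw [one_smul, k_mul_l]) j

theorem pbw_mul_k_zpow (i : PBWIndex) (j : ℤ) : pbw i * (k ^ j : MUˣ) ∈ pbwSpan := by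
  have h : ∃ i', pbw i' = pbw i * (k ^ j : MUˣ) := by
    rcases i with ⟨r, s, t⟩ | ⟨r, s, t⟩ | ⟨r, s, t, h⟩ | ⟨r, s, t, h, h'⟩ | ⟨r, s, t, h, h'⟩ |
      ⟨r, s, t, h, h'⟩
    · exact ⟨.B₀ r s (t + j), by simp only [pbw, mul_assoc, zpow_add, Units.val_mul]⟩
    · exact ⟨.B₁ r s (t + j), by simp only [pbw, mul_assoc, zpow_add, Units.val_mul]⟩
    · exact ⟨.B₂ r s (t + j) h, by simp only [pbw, mul_assoc, zpow_add, Units.val_mul]⟩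
    · exact ⟨.B₃ r s (t + j) h h', by simp only [pbw, mul_assoc, zpow_add, Units.val_mul]⟩
    · exact ⟨.B₄ r s (t + j) h h', by simp only [pbw, mul_assoc, zpow_add, Units.val_mul]⟩
    · exact ⟨.B₅ r s (t + j) h h', by simp only [pbw, mul_assoc, zpow_add, Units.val_mul]⟩
  obtain ⟨i', h⟩ := h
  exact h ▸ Submodule.subset_span ⟨i', rfl⟩

theorem mul_k_zpow_mem {x : MU} (hx : x ∈ pbwSpan) (j : ℤ) :
    x * (k ^ j : MUˣ) ∈ pbwSpan := by
  refine Submodule.span_le (p := pbwSpan.comap (LinearMap.mulRight Cv ((k ^ j : MUˣ) : MU))).mpr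
    ?_ hx
  rintro _ ⟨i, rfl⟩
  exact pbw_mul_k_zpow i j

theorem pbw_mem (i : PBWIndex) : pbw i ∈ pbwSpan := Submodule.subset_span ⟨i, rfl⟩

theorem f_pow_e_pow_mem (r s : ℕ) : f ^ r * e ^ s ∈ pbwSpan := by
  simpa [pbw] using pbw_mem (.B₀ r s 0)

theorem l_f_pow_e_pow_mem (r s : ℕ) : l * f ^ r * e ^ s ∈ pbwSpan := by
  simpa [pbw] using pbw_mem (.B₁ r s 0)

theorem f_pow_e_pow_l_mem (r s : ℕ) : f ^ r * e ^ s * l ∈ pbwSpan := by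
  by_cases h : (r, s) = (0, 0)
  · obtain ⟨rfl, rfl⟩ := Prod.mk.inj h
    simpa using l_f_pow_e_pow_mem 0 0
  · simpa [pbw] using pbw_mem (.B₂ r s 0 h)

theorem l_f_pow_e_pow_l_mem (r s : ℕ) : l * f ^ r * e ^ s * l ∈ pbwSpan := by
  rcases r.eq_zero_or_pos with rfl | hr
  · rw [pow_zero, mul_one, l_mul_e_pow_mul_l]
    simpa using l_f_pow_e_pow_mem 0 s
  rcases s.eq_zero_or_pos with rfl | hs
  · rw [pow_zero, mul_one, l_mul_f_pow_mul_l]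
    simpa using f_pow_e_pow_l_mem r 0
  simpa [pbw] using pbw_mem (.B₃ r s 0 hr hs)

theorem f_pow_l_e_pow_mem (r s : ℕ) : f ^ r * l * e ^ s ∈ pbwSpan := by
  rcases r.eq_zero_or_pos with rfl | hr
  · simpa using l_f_pow_e_pow_mem 0 s
  rcases s.eq_zero_or_pos with rfl | hs
  · simpa using f_pow_e_pow_l_mem r 0
  simpa [pbw] using pbw_mem (.B₄ r s 0 hr hs)

theorem e_pow_l_f_pow_mem (s r : ℕ) : e ^ s * l * f ^ r ∈ pbwSpan := by
  rcases r.eq_zero_or_pos with rfl | hr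
  · simpa using f_pow_e_pow_l_mem 0 s
  rcases s.eq_zero_or_pos with rfl | hs
  · simpa using l_f_pow_e_pow_mem r 0
  simpa [pbw] using pbw_mem (.B₅ r s 0 hr hs)

/-- The subalgebra generated by `e, f, k, k⁻¹`, the image of quantum `sl₂`. -/
noncomputable def quantumSl2 : Subalgebra Cv MU :=
  Algebra.adjoin Cv {e, f, (k : MU), ((k⁻¹ : MUˣ) : MU)}

theorem e_mem : e ∈ quantumSl2 := Algebra.subset_adjoin (by simp)

theorem f_mem : f ∈ quantumSl2 := Algebra.subset_adjoin (by simp)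

theorem quantumSl2_le_span_f_e {u : MU} (hu : u ∈ quantumSl2) :
    u ∈ Submodule.span Cv
      (Set.range fun i : ℕ × ℕ × ℤ ↦ f ^ i.1 * e ^ i.2.1 * (k ^ i.2.2 : MUˣ)) :=
  adjoin_le_span (pow_ne_zero 2 v_ne_zero) (pow_ne_zero 2 (inv_ne_zero v_ne_zero)) k_mul_e k_mul_f
    e_mul_f hu

theorem quantumSl2_le_span_e_f {u : MU} (hu : u ∈ quantumSl2) :
    u ∈ Submodule.span Cv
      (Set.range fun i : ℕ × ℕ × ℤ ↦ e ^ i.1 * f ^ i.2.1 * (k ^ i.2.2 : MUˣ)) := by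
  refine adjoin_le_span (pow_ne_zero 2 (inv_ne_zero v_ne_zero)) (pow_ne_zero 2 v_ne_zero) k_mul_f
    k_mul_e f_mul_e ?_
  rwa [quantumSl2, Set.insert_comm] at hu

/-- If `u` is a combination of `g r s kᵗ` and `y` commutes with `k`, then `x u y` lies in the span
of the PBW monomials as soon as all `x (g r s) y` do. -/
theorem sandwich_mem {g : ℕ → ℕ → MU} {x y u : MU} (hy : ∀ j : ℤ, Commute y ((k ^ j : MUˣ) : MU))
    (hu : u ∈ Submodule.span Cv
      (Set.range fun i : ℕ × ℕ × ℤ ↦ g i.1 i.2.1 * (k ^ i.2.2 : MUˣ)))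
    (h : ∀ r s, x * g r s * y ∈ pbwSpan) : x * u * y ∈ pbwSpan := by
  refine Submodule.span_le
    (p := pbwSpan.comap (LinearMap.mulRight Cv y ∘ₗ LinearMap.mulLeft Cv x)).mpr ?_ hu
  rintro _ ⟨⟨r, s, t⟩, rfl⟩
  have h1 := mul_k_zpow_mem (h r s) t
  rwa [mul_assoc, (hy t).eq, ← mul_assoc, mul_assoc x] at h1

theorem commute_l (j : ℤ) : Commute l ((k ^ j : MUˣ) : MU) := (k_zpow_mul_l j).symm

theorem commute_one (j : ℤ) : Commute 1 ((k ^ j : MUˣ) : MU) := Commute.one_left _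

theorem mem_of_mem_quantumSl2 {u : MU} (hu : u ∈ quantumSl2) : u ∈ pbwSpan := by
  simpa using sandwich_mem (x := 1) (g := fun r s ↦ f ^ r * e ^ s) commute_one
    (quantumSl2_le_span_f_e hu) fun r s ↦ by simpa using f_pow_e_pow_mem r s

theorem mul_l_mem {u : MU} (hu : u ∈ quantumSl2) : u * l ∈ pbwSpan := by
  simpa using sandwich_mem (x := 1) (g := fun r s ↦ f ^ r * e ^ s) commute_l
    (quantumSl2_le_span_f_e hu) fun r s ↦ by simpa using f_pow_e_pow_l_mem r s

theorem l_mul_mem {u : MU} (hu : u ∈ quantumSl2) : l * u ∈ pbwSpan := by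
  simpa using sandwich_mem (x := l) (g := fun r s ↦ f ^ r * e ^ s) commute_one
    (quantumSl2_le_span_f_e hu) fun r s ↦ by
      simpa [mul_assoc] using l_f_pow_e_pow_mem r s

theorem l_mul_mul_l_mem {u : MU} (hu : u ∈ quantumSl2) : l * u * l ∈ pbwSpan :=
  sandwich_mem (g := fun r s ↦ f ^ r * e ^ s) commute_l (quantumSl2_le_span_f_e hu) fun r s ↦ by
    simpa [mul_assoc] using l_f_pow_e_pow_l_mem r s

theorem e_mul_l_mul_mem {u : MU} (hu : u ∈ quantumSl2) : e * l * u ∈ pbwSpan := by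
  have h := sandwich_mem (x := e * l) (g := fun s r ↦ e ^ s * f ^ r) commute_one
    (quantumSl2_le_span_e_f hu) fun s r ↦ ?_
  · simpa using h
  · obtain ⟨α, β, h⟩ := e_mul_l_mul_e_pow s
    rw [mul_one, ← mul_assoc, h, add_mul, smul_mul_assoc, smul_mul_assoc, mul_assoc l]
    exact add_mem (pbwSpan.smul_mem _ (e_pow_l_f_pow_mem _ _))
      (pbwSpan.smul_mem _ (l_mul_mem (mul_mem (pow_mem e_mem _) (pow_mem f_mem _))))

theorem e_mul_l_mul_mul_l_mem {u : MU} (hu : u ∈ quantumSl2) : e * l * u * l ∈ pbwSpan := by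
  refine sandwich_mem (x := e * l) (g := fun s r ↦ e ^ s * f ^ r) commute_l
    (quantumSl2_le_span_e_f hu) fun s r ↦ ?_
  obtain ⟨α, β, h⟩ := e_mul_l_mul_e_pow s
  rw [← mul_assoc, h, add_mul, smul_mul_assoc, smul_mul_assoc, add_mul, smul_mul_assoc,
    smul_mul_assoc, mul_assoc (_ * l), mul_assoc _ l, ← mul_assoc l, l_mul_f_pow_mul_l,
    ← mul_assoc (e ^ _), mul_assoc l]
  exact add_mem
    (pbwSpan.smul_mem _ (mul_l_mem (mul_mem (pow_mem e_mem _) (pow_mem f_mem _))))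
    (pbwSpan.smul_mem _ (l_mul_mul_l_mem (mul_mem (pow_mem e_mem _) (pow_mem f_mem _))))

/-- Left multiplication by `x` preserves the span as soon as it maps the monomials without a
power of `k` into it. -/
theorem mul_mem_pbwSpan {x n : MU} (hn : n ∈ pbwSpan)
    (h₀ : ∀ r s, x * (f ^ r * e ^ s) ∈ pbwSpan) (h₁ : ∀ r s, x * (l * f ^ r * e ^ s) ∈ pbwSpan)
    (h₂ : ∀ r s, x * (f ^ r * e ^ s * l) ∈ pbwSpan)
    (h₃ : ∀ r s, x * (l * f ^ r * e ^ s * l) ∈ pbwSpan)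
    (h₄ : ∀ r s, x * (f ^ r * l * e ^ s) ∈ pbwSpan)
    (h₅ : ∀ r s, x * (e ^ s * l * f ^ r) ∈ pbwSpan) : x * n ∈ pbwSpan := by
  refine mul_mem_of_mem_span hn ?_
  rintro _ ⟨⟨r, s, t⟩ | ⟨r, s, t⟩ | ⟨r, s, t, h⟩ | ⟨r, s, t, h, h'⟩ | ⟨r, s, t, h, h'⟩ |
      ⟨r, s, t, h, h'⟩, rfl⟩ <;> rw [pbw, ← mul_assoc x]
  exacts [mul_k_zpow_mem (h₀ r s) t, mul_k_zpow_mem (h₁ r s) t, mul_k_zpow_mem (h₂ r s) t,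
    mul_k_zpow_mem (h₃ r s) t, mul_k_zpow_mem (h₄ r s) t, mul_k_zpow_mem (h₅ r s) t]

theorem f_pow_mul_e_pow_mem (r s : ℕ) : f ^ r * e ^ s ∈ quantumSl2 :=
  mul_mem (pow_mem f_mem _) (pow_mem e_mem _)

theorem e_pow_mul_f_pow_mem (r s : ℕ) : e ^ r * f ^ s ∈ quantumSl2 :=
  mul_mem (pow_mem e_mem _) (pow_mem f_mem _)

theorem l_mul_mem_pbwSpan {n : MU} (hn : n ∈ pbwSpan) : l * n ∈ pbwSpan := by
  refine mul_mem_pbwSpan hn (fun r s ↦ ?_) (fun r s ↦ ?_) (fun r s ↦ ?_) (fun r s ↦ ?_)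
    (fun r s ↦ ?_) (fun r s ↦ ?_)
  · exact l_mul_mem (f_pow_mul_e_pow_mem r s)
  · rw [← mul_assoc, ← mul_assoc, l_mul_l]
    exact l_f_pow_e_pow_mem r s
  · rw [← mul_assoc]
    exact l_mul_mul_l_mem (f_pow_mul_e_pow_mem r s)
  · rw [← mul_assoc, ← mul_assoc, ← mul_assoc, l_mul_l]
    exact l_f_pow_e_pow_l_mem r s
  · rw [← mul_assoc, ← mul_assoc, l_mul_f_pow_mul_l]
    exact f_pow_l_e_pow_mem r s
  · rw [← mul_assoc, ← mul_assoc, l_mul_e_pow_mul_l, mul_assoc]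
    exact l_mul_mem (e_pow_mul_f_pow_mem s r)

theorem k_zpow_mul_l_mul_e_pow (j : ℤ) (s : ℕ) :
    ∃ c : Cv, ((k ^ j : MUˣ) : MU) * (l * e ^ s) = c • (l * e ^ s * (k ^ j : MUˣ)) :=
  ⟨_, by rw [← mul_assoc, k_zpow_mul_l, mul_assoc,
    mul_pow_of_mul (zpow_mul_of_mul (pow_ne_zero 2 v_ne_zero) k_mul_e j) s, mul_smul_comm,
    mul_assoc]⟩

theorem k_zpow_mul_l_mul_f_pow (j : ℤ) (s : ℕ) :
    ∃ c : Cv, ((k ^ j : MUˣ) : MU) * (l * f ^ s) = c • (l * f ^ s * (k ^ j : MUˣ)) :=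
  ⟨_, by rw [← mul_assoc, k_zpow_mul_l, mul_assoc,
    mul_pow_of_mul (zpow_mul_of_mul (pow_ne_zero 2 (inv_ne_zero v_ne_zero)) k_mul_f j) s,
    mul_smul_comm, mul_assoc]⟩

theorem f_pow_k_zpow_l_e_pow_mem (r s : ℕ) (j : ℤ) :
    f ^ r * ((k ^ j : MUˣ) : MU) * (l * e ^ s) ∈ pbwSpan := by
  obtain ⟨c, h⟩ := k_zpow_mul_l_mul_e_pow j s
  rw [mul_assoc, h, mul_smul_comm, ← mul_assoc, ← mul_assoc]
  exact pbwSpan.smul_mem c (mul_k_zpow_mem (f_pow_l_e_pow_mem r s) j)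

theorem e_pow_k_zpow_l_f_pow_mem (s r : ℕ) (j : ℤ) :
    e ^ s * ((k ^ j : MUˣ) : MU) * (l * f ^ r) ∈ pbwSpan := by
  obtain ⟨c, h⟩ := k_zpow_mul_l_mul_f_pow j r
  rw [mul_assoc, h, mul_smul_comm, ← mul_assoc, ← mul_assoc]
  exact pbwSpan.smul_mem c (mul_k_zpow_mem (e_pow_l_f_pow_mem s r) j)

theorem e_mul_f_pow_l_e_pow_mem (r s : ℕ) : e * (f ^ r * l * e ^ s) ∈ pbwSpan := by
  have h1 : ∀ r, f ^ r * (e * l * e ^ s) ∈ pbwSpan := by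
    intro r
    obtain ⟨α, β, h⟩ := e_mul_l_mul_e_pow s
    rw [h, mul_add, mul_smul_comm, mul_smul_comm, ← mul_assoc, ← mul_assoc]
    exact add_mem (pbwSpan.smul_mem _ (f_pow_e_pow_l_mem _ _))
      (pbwSpan.smul_mem _ (f_pow_l_e_pow_mem _ _))
  cases r with
  | zero => simpa [mul_assoc] using h1 0
  | succ r =>
    obtain ⟨α, β, h⟩ := e_mul_f_pow r
    rw [mul_assoc (f ^ _), ← mul_assoc e, h, add_mul, add_mul, smul_mul_assoc, smul_mul_assoc,
      mul_assoc _ e, ← mul_assoc e]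
    refine add_mem (h1 _) (add_mem (pbwSpan.smul_mem _ ?_) (pbwSpan.smul_mem _ ?_))
    · simpa using f_pow_k_zpow_l_e_pow_mem r s 1
    · simpa using f_pow_k_zpow_l_e_pow_mem r s (-1)

theorem f_mul_e_pow_l_f_pow_mem (r s : ℕ) : f * (e ^ s * l * f ^ r) ∈ pbwSpan := by
  have h1 : ∀ s, e ^ s * (f * l * f ^ r) ∈ pbwSpan := by
    intro s
    obtain ⟨α, β, h⟩ := f_mul_l_mul_f_pow r
    rw [h, mul_add, mul_smul_comm, mul_smul_comm, ← mul_assoc, ← mul_assoc]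
    exact add_mem (pbwSpan.smul_mem _ (mul_l_mem (e_pow_mul_f_pow_mem _ _)))
      (pbwSpan.smul_mem _ (e_pow_l_f_pow_mem _ _))
  cases s with
  | zero => simpa [mul_assoc] using h1 0
  | succ s =>
    obtain ⟨α, β, h⟩ := f_mul_e_pow s
    rw [mul_assoc (e ^ _), ← mul_assoc f, h, add_mul, add_mul, smul_mul_assoc, smul_mul_assoc,
      mul_assoc _ f, ← mul_assoc f]
    refine add_mem (h1 _) (add_mem (pbwSpan.smul_mem _ ?_) (pbwSpan.smul_mem _ ?_))
    · simpa using e_pow_k_zpow_l_f_pow_mem s r 1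
    · simpa using e_pow_k_zpow_l_f_pow_mem s r (-1)

theorem e_mul_mem_pbwSpan {n : MU} (hn : n ∈ pbwSpan) : e * n ∈ pbwSpan := by
  refine mul_mem_pbwSpan hn (fun r s ↦ ?_) (fun r s ↦ ?_) (fun r s ↦ ?_) (fun r s ↦ ?_)
    e_mul_f_pow_l_e_pow_mem (fun r s ↦ ?_)
  · exact mem_of_mem_quantumSl2 (mul_mem e_mem (f_pow_mul_e_pow_mem r s))
  · rw [mul_assoc l, ← mul_assoc]
    exact e_mul_l_mul_mem (f_pow_mul_e_pow_mem r s)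
  · rw [← mul_assoc]
    exact mul_l_mem (mul_mem e_mem (f_pow_mul_e_pow_mem r s))
  · rw [mul_assoc l, ← mul_assoc, ← mul_assoc]
    exact e_mul_l_mul_mul_l_mem (f_pow_mul_e_pow_mem r s)
  · rw [← mul_assoc, ← mul_assoc, ← pow_succ']
    exact e_pow_l_f_pow_mem _ _

theorem f_mul_mem_pbwSpan {n : MU} (hn : n ∈ pbwSpan) : f * n ∈ pbwSpan := by
  refine mul_mem_pbwSpan hn (fun r s ↦ ?_) (fun r s ↦ ?_) (fun r s ↦ ?_) (fun r s ↦ ?_)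
    (fun r s ↦ ?_) f_mul_e_pow_l_f_pow_mem
  · rw [← mul_assoc, ← pow_succ']
    exact f_pow_e_pow_mem _ _
  · obtain ⟨α, β, h⟩ := f_mul_l_mul_f_pow r
    rw [← mul_assoc, ← mul_assoc, h, add_mul, smul_mul_assoc, smul_mul_assoc]
    exact add_mem (pbwSpan.smul_mem _ (f_pow_l_e_pow_mem _ _))
      (pbwSpan.smul_mem _ (l_f_pow_e_pow_mem _ _))
  · rw [← mul_assoc, ← mul_assoc, ← pow_succ']
    exact f_pow_e_pow_l_mem _ _
  · obtain ⟨α, β, h⟩ := f_mul_l_mul_f_pow r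
    rw [← mul_assoc, ← mul_assoc, ← mul_assoc, h, add_mul, smul_mul_assoc, smul_mul_assoc,
      add_mul, smul_mul_assoc, smul_mul_assoc, mul_assoc (f ^ _), mul_assoc (f ^ _),
      l_mul_e_pow_mul_l, ← mul_assoc]
    exact add_mem (pbwSpan.smul_mem _ (f_pow_l_e_pow_mem _ _))
      (pbwSpan.smul_mem _ (l_f_pow_e_pow_l_mem _ _))
  · rw [← mul_assoc, ← mul_assoc, ← pow_succ']
    exact f_pow_l_e_pow_mem _ _

theorem k_zpow_mul_mem_pbwSpan (j : ℤ) {n : MU} (hn : n ∈ pbwSpan) :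
    ((k ^ j : MUˣ) : MU) * n ∈ pbwSpan := by
  have hkj : ((k ^ j : MUˣ) : MU) ∈ quantumSl2 := by
    obtain ⟨m, rfl | rfl⟩ := j.eq_nat_or_neg
    · rw [zpow_natCast, Units.val_pow_eq_pow_val]
      exact pow_mem (Algebra.subset_adjoin (by simp)) m
    · rw [zpow_neg, ← inv_zpow, zpow_natCast, Units.val_pow_eq_pow_val]
      exact pow_mem (Algebra.subset_adjoin (by simp)) m
  have hl : ∀ x : MU, ((k ^ j : MUˣ) : MU) * (l * x) = l * ((k ^ j : MUˣ) * x) := fun x ↦ by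
    rw [← mul_assoc, k_zpow_mul_l, mul_assoc]
  refine mul_mem_pbwSpan hn (fun r s ↦ ?_) (fun r s ↦ ?_) (fun r s ↦ ?_) (fun r s ↦ ?_)
    (fun r s ↦ ?_) (fun r s ↦ ?_)
  · exact mem_of_mem_quantumSl2 (mul_mem hkj (f_pow_mul_e_pow_mem r s))
  · rw [mul_assoc l, hl]
    exact l_mul_mem (mul_mem hkj (f_pow_mul_e_pow_mem r s))
  · rw [← mul_assoc]
    exact mul_l_mem (mul_mem hkj (f_pow_mul_e_pow_mem r s))
  · rw [mul_assoc l, mul_assoc l, hl, ← mul_assoc, ← mul_assoc, mul_assoc l]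
    exact l_mul_mul_l_mem (mul_mem hkj (f_pow_mul_e_pow_mem r s))
  · rw [mul_assoc (f ^ r), ← mul_assoc,
      mul_pow_of_mul (zpow_mul_of_mul (pow_ne_zero 2 (inv_ne_zero v_ne_zero)) k_mul_f j) r,
      smul_mul_assoc]
    exact pbwSpan.smul_mem _ (f_pow_k_zpow_l_e_pow_mem r s j)
  · rw [mul_assoc (e ^ s), ← mul_assoc,
      mul_pow_of_mul (zpow_mul_of_mul (pow_ne_zero 2 v_ne_zero) k_mul_e j) s, smul_mul_assoc]
    exact pbwSpan.smul_mem _ (e_pow_k_zpow_l_f_pow_mem s r j)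

theorem pbwSpan_eq_top : pbwSpan = ⊤ := by
  rw [eq_top_iff]
  rintro x -
  obtain ⟨x, rfl⟩ := RingQuot.mkAlgHom_surjective Cv Rel x
  have h : ∀ n ∈ pbwSpan, mk x * n ∈ pbwSpan := by
    induction x using FreeAlgebra.induction with
    | grade0 r => intro n hn; rw [AlgHom.commutes, ← Algebra.smul_def]; exact pbwSpan.smul_mem r hn
    | grade1 g =>
      intro n hn
      cases g with
      | e => exact e_mul_mem_pbwSpan hn
      | f => exact f_mul_mem_pbwSpan hn
      | k => simpa only [zpow_one] using! k_zpow_mul_mem_pbwSpan 1 hn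
      | kInv => simpa only [zpow_neg_one] using! k_zpow_mul_mem_pbwSpan (-1) hn
      | l => exact l_mul_mem_pbwSpan hn
    | mul x y hx hy => intro n hn; rw [map_mul, mul_assoc]; exact hx _ (hy n hn)
    | add x y hx hy => intro n hn; rw [map_add, add_mul]; exact add_mem (hx n hn) (hy n hn)
  have h1 : (1 : MU) ∈ pbwSpan := by simpa using f_pow_e_pow_mem 0 0
  have h2 := h 1 h1
  rwa [mul_one] at h2

end MU

/-! ### A universal weight module for quantum `sl₂` -/

/-- A family is linearly independent if there are functionals which are triangular on it for some
grading of the index set. -/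
theorem linearIndependent_of_triangular {ι V : Type*} [AddCommGroup V] [Module Cv V] {w : ι → V}
    (deg : ι → ℕ) (ξ : ι → V →ₗ[Cv] Cv) (h₁ : ∀ i, ξ i (w i) ≠ 0)
    (h₀ : ∀ i j, j ≠ i → deg j ≤ deg i → ξ i (w j) = 0) : LinearIndependent Cv w := by
  rw [linearIndependent_iff]
  intro c hc
  by_contra hne
  obtain ⟨i, hi, hmax⟩ := c.support.exists_max_image deg (Finsupp.support_nonempty_iff.mpr hne)
  have h := congrArg (ξ i) hc
  rw [Finsupp.linearCombination_apply, map_finsuppSum, map_zero, Finsupp.sum,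
    Finset.sum_eq_single i] at h
  · rw [map_smul, smul_eq_mul] at h
    exact mul_ne_zero (Finsupp.mem_support_iff.mp hi) (h₁ i) h
  · intro j hj hji
    rw [map_smul, h₀ i j hji (hmax j hj), smul_zero]
  · exact fun h ↦ absurd hi h

/-- The coefficient ring: polynomials in a free Casimir parameter over Laurent polynomials in a
free weight parameter. -/
abbrev Coeff : Type := (LaurentPolynomial Cv)[X]

/-- The algebra of operators on the weight module, whose weight spaces are indexed by `ℤ` and are
free of rank one over `Coeff`. -/
abbrev Op : Type := Module.End Coeff (ℤ → Coeff)

/-- The Laurent monomial `λᵗ` in the weight parameter. -/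
noncomputable def wt (t : ℤ) : Coeff := Polynomial.C (LaurentPolynomial.T t)

theorem wt_add (s t : ℤ) : wt (s + t) = wt s * wt t := by
  rw [wt, LaurentPolynomial.T_add, Polynomial.C_mul, wt, wt]

theorem wt_zero : wt 0 = 1 := by
  rw [wt, LaurentPolynomial.T_zero, Polynomial.C_1]

theorem wt_one_mul_wt_neg_one : wt 1 * wt (-1) = 1 := by
  rw [← wt_add, add_neg_cancel, wt_zero]

/-- The structure constants of the lowering operator. They solve the difference equation
`casimir (n + 1) - casimir n = (λv⁻²ⁿ - v⁻²λ⁻¹v²ⁿ) / (v - v⁻¹)`, with the polynomial variable as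
the constant of integration. -/
noncomputable def casimir (n : ℤ) : Coeff :=
  Polynomial.X + ((v - v⁻¹)⁻¹ * (v⁻¹ ^ 2 - 1)⁻¹ * (v⁻¹ ^ 2) ^ n) • wt 1 +
    (-((v - v⁻¹)⁻¹ * v⁻¹ ^ 2 * (v ^ 2 - 1)⁻¹) * (v ^ 2) ^ n) • wt (-1)

theorem casimir_add_one_sub (n : ℤ) : casimir (n + 1) - casimir n =
    ((v - v⁻¹)⁻¹ * (v⁻¹ ^ 2) ^ n) • wt 1 -
      ((v - v⁻¹)⁻¹ * v⁻¹ ^ 2 * (v ^ 2) ^ n) • wt (-1) := by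
  have h1 : v⁻¹ ^ 2 - 1 ≠ 0 := by
    simpa [sub_eq_zero] using v_inv_sq_pow_ne_one 1 one_ne_zero
  have h2 : v ^ 2 - 1 ≠ 0 := by simpa [sub_eq_zero] using v_sq_pow_ne_one 1 one_ne_zero
  have h3 (c q : Cv) (hq : q ≠ 0) (h : q - 1 ≠ 0) :
      c * (q - 1)⁻¹ * q ^ (n + 1) = c * (q - 1)⁻¹ * q ^ n + c * q ^ n := by
    rw [zpow_add_one₀ hq]
    field_simp
    ring
  rw [casimir, casimir, ← neg_mul, h3 _ _ (pow_ne_zero 2 (inv_ne_zero v_ne_zero)) h1,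
    h3 _ _ (pow_ne_zero 2 v_ne_zero) h2, add_smul, add_smul]
  simp only [neg_mul, neg_smul]
  abel

theorem casimir_monic (n : ℤ) : (casimir n).Monic ∧ (casimir n).natDegree = 1 := by
  have h : casimir n = Polynomial.X + Polynomial.C
      (((v - v⁻¹)⁻¹ * (v⁻¹ ^ 2 - 1)⁻¹ * (v⁻¹ ^ 2) ^ n) • LaurentPolynomial.T 1 +
        (-((v - v⁻¹)⁻¹ * v⁻¹ ^ 2 * (v ^ 2 - 1)⁻¹) * (v ^ 2) ^ n) • LaurentPolynomial.T (-1)) := by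
    rw [casimir, Polynomial.C_add, wt, wt, Polynomial.smul_C, Polynomial.smul_C, add_assoc]
  rw [h]
  exact ⟨Polynomial.monic_X_add_C _, Polynomial.natDegree_X_add_C _⟩

/-- The operator by which `e` lowers the index of a weight space. -/
noncomputable def opE : Op where
  toFun φ n := casimir (n + 1) * φ (n + 1)
  map_add' φ ψ := by ext1 n; simp [mul_add]
  map_smul' c φ := by ext1 n; simp [mul_left_comm]

/-- The operator by which `f` raises the index of a weight space. -/
def opF : Op where
  toFun φ n := φ (n - 1)
  map_add' _ _ := rfl
  map_smul' _ _ := rfl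

/-- The operator acting on the `n`-th weight space by `λv⁻²ⁿ`. -/
noncomputable def opK : Opˣ where
  val :=
    { toFun := fun φ n ↦ (v⁻¹ ^ 2) ^ n • (wt 1 * φ n)
      map_add' := fun φ ψ ↦ by ext1 n; simp [mul_add]
      map_smul' := fun c φ ↦ by ext1 n; simp [mul_left_comm] }
  inv :=
    { toFun := fun φ n ↦ (v ^ 2) ^ n • (wt (-1) * φ n)
      map_add' := fun φ ψ ↦ by ext1 n; simp [mul_add]
      map_smul' := fun c φ ↦ by ext1 n; simp [mul_left_comm] }
  val_inv := by
    ext1 φ; ext1 n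
    change (v⁻¹ ^ 2) ^ n • (wt 1 * (v ^ 2) ^ n • (wt (-1) * φ n)) = φ n
    rw [mul_smul_comm, smul_smul, ← mul_zpow, ← mul_pow, inv_mul_cancel₀ v_ne_zero, one_pow,
      one_zpow, one_smul, ← mul_assoc, wt_one_mul_wt_neg_one, one_mul]
  inv_val := by
    ext1 φ; ext1 n
    change (v ^ 2) ^ n • (wt (-1) * (v⁻¹ ^ 2) ^ n • (wt 1 * φ n)) = φ n
    rw [mul_smul_comm, smul_smul, ← mul_zpow, ← mul_pow, mul_inv_cancel₀ v_ne_zero, one_pow,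
      one_zpow, one_smul, ← mul_assoc, mul_comm (wt (-1)), wt_one_mul_wt_neg_one, one_mul]

theorem opE_apply (φ : ℤ → Coeff) (n : ℤ) : opE φ n = casimir (n + 1) * φ (n + 1) := rfl

theorem opF_apply (φ : ℤ → Coeff) (n : ℤ) : opF φ n = φ (n - 1) := rfl

theorem opK_apply (φ : ℤ → Coeff) (n : ℤ) :
    (opK : Op) φ n = (v⁻¹ ^ 2) ^ n • (wt 1 * φ n) := rfl

theorem opK_inv_apply (φ : ℤ → Coeff) (n : ℤ) :
    ((opK⁻¹ : Opˣ) : Op) φ n = (v ^ 2) ^ n • (wt (-1) * φ n) := rfl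

theorem opK_mul_opE : (opK : Op) * opE = v ^ 2 • (opE * (opK : Op)) := by
  ext1 φ; ext1 n
  simp only [Module.End.mul_apply, LinearMap.smul_apply, Pi.smul_apply, opK_apply, opE_apply,
    mul_smul_comm, smul_smul]
  congr 1
  · rw [zpow_add_one₀ (pow_ne_zero 2 (inv_ne_zero v_ne_zero)), mul_left_comm, ← mul_pow,
      mul_inv_cancel₀ v_ne_zero, one_pow, mul_one]
  · ring

theorem opK_mul_opF : (opK : Op) * opF = v⁻¹ ^ 2 • (opF * (opK : Op)) := by
  ext1 φ; ext1 n
  simp only [Module.End.mul_apply, LinearMap.smul_apply, Pi.smul_apply, opK_apply, opF_apply,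
    smul_smul]
  rw [zpow_sub_one₀ (pow_ne_zero 2 (inv_ne_zero v_ne_zero)), mul_left_comm,
    mul_inv_cancel₀ (pow_ne_zero 2 (inv_ne_zero v_ne_zero)), mul_one]

theorem opE_mul_opF : opE * opF - opF * opE =
    (v - v⁻¹)⁻¹ • ((opK : Op) - v⁻¹ ^ 2 • ((opK⁻¹ : Opˣ) : Op)) := by
  ext1 φ; ext1 n
  simp only [Module.End.mul_apply, LinearMap.smul_apply, Pi.smul_apply, LinearMap.sub_apply,
    Pi.sub_apply, opK_apply, opK_inv_apply, opF_apply, opE_apply, sub_add_cancel,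
    add_sub_cancel_right]
  rw [← sub_mul, casimir_add_one_sub, sub_mul, smul_sub, smul_mul_assoc, smul_mul_assoc, smul_smul,
    smul_smul, smul_smul, mul_assoc]

/-- The vector `p` placed in the `n`-th weight space. -/
noncomputable abbrev wtVec (n : ℤ) (p : Coeff) : ℤ → Coeff := Pi.single n p

theorem opE_wtVec (n : ℤ) (p : Coeff) : opE (wtVec n p) = wtVec (n - 1) (casimir n * p) := by
  ext1 m
  rw [opE_apply]
  by_cases h : m = n - 1
  · subst h
    simp [wtVec]
  · rw [wtVec, wtVec, Pi.single_eq_of_ne h, Pi.single_eq_of_ne (by omega), mul_zero]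

theorem opF_wtVec (n : ℤ) (p : Coeff) : opF (wtVec n p) = wtVec (n + 1) p := by
  ext1 m
  rw [opF_apply]
  by_cases h : m = n + 1
  · subst h
    simp [wtVec]
  · rw [wtVec, wtVec, Pi.single_eq_of_ne h, Pi.single_eq_of_ne (by omega)]

theorem opE_pow_wtVec (s : ℕ) (n : ℤ) : ∃ P : Coeff, P.Monic ∧ P.natDegree = s ∧
    ∀ p, (opE ^ s) (wtVec n p) = wtVec (n - s) (P * p) := by
  induction s with
  | zero => exact ⟨1, Polynomial.monic_one, Polynomial.natDegree_one, fun p ↦ by simp⟩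
  | succ s ih =>
    obtain ⟨P, hP, hs, h⟩ := ih
    obtain ⟨h1, h2⟩ := casimir_monic (n - s)
    refine ⟨casimir (n - s) * P, h1.mul hP, by rw [h1.natDegree_mul hP, h2, hs, add_comm],
      fun p ↦ ?_⟩
    rw [pow_succ', Module.End.mul_apply, h, opE_wtVec, Nat.cast_succ, sub_sub, mul_assoc]

theorem opF_pow_wtVec (r : ℕ) (n : ℤ) (p : Coeff) :
    (opF ^ r) (wtVec n p) = wtVec (n + r) p := by
  induction r with
  | zero => simp
  | succ r ih => rw [pow_succ', Module.End.mul_apply, ih, opF_wtVec, Nat.cast_succ, add_assoc]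

theorem opK_zpow_wtVec (t : ℤ) : ((opK ^ t : Opˣ) : Op) (wtVec 0 1) = wtVec 0 (wt t) := by
  have h1 : ∀ p, (opK : Op) (wtVec 0 p) = wtVec 0 (wt 1 * p) := by
    intro p; ext1 m
    rw [opK_apply]
    by_cases h : m = 0
    · subst h; simp [wtVec]
    · rw [wtVec, wtVec, Pi.single_eq_of_ne h, Pi.single_eq_of_ne h, mul_zero, smul_zero]
  have h2 : ∀ p, ((opK⁻¹ : Opˣ) : Op) (wtVec 0 p) = wtVec 0 (wt (-1) * p) := by
    intro p; ext1 m
    rw [opK_inv_apply]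
    by_cases h : m = 0
    · subst h; simp [wtVec]
    · rw [wtVec, wtVec, Pi.single_eq_of_ne h, Pi.single_eq_of_ne h, mul_zero, smul_zero]
  induction t using Int.induction_on with
  | zero => rw [zpow_zero, Units.val_one, Module.End.one_apply, wt_zero]
  | succ i ih =>
    rw [add_comm, zpow_one_add, Units.val_mul, Module.End.mul_apply, ih, h1, ← wt_add]
  | pred i ih =>
    rw [sub_eq_neg_add, zpow_add, zpow_neg_one, Units.val_mul, Module.End.mul_apply, ih, h2,
      ← wt_add]

/-- The functional extracting the coefficient of `Xˢλᵗ` in the `n`-th weight space. -/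
noncomputable def coeffAt (n : ℤ) (s : ℕ) (t : ℤ) : (ℤ → Coeff) →ₗ[Cv] Cv where
  toFun φ := ((φ n).coeff s).coeff t
  map_add' _ _ := by simp
  map_smul' _ _ := by simp

/-- Triangularity with respect to the degree in the Casimir parameter. -/
theorem linearIndependent_of_monic {w : ℕ × ℕ × ℤ → ℤ → Coeff}
    (h : ∀ r s, ∃ P : Coeff, P.Monic ∧ P.natDegree = s ∧
      ∀ t, w (r, s, t) = wtVec ((r : ℤ) - s) (P * wt t)) : LinearIndependent Cv w := by
  refine linearIndependent_of_triangular (fun i ↦ i.2.1)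
    (fun i ↦ coeffAt ((i.1 : ℤ) - i.2.1) i.2.1 i.2.2) ?_ ?_
  · rintro ⟨r, s, t⟩
    obtain ⟨P, hP, rfl, hw⟩ := h r s
    simp only [hw, coeffAt, LinearMap.coe_mk, AddHom.coe_mk, wtVec, wt, Pi.single_eq_same,
      Polynomial.coeff_mul_C, hP.coeff_natDegree, one_mul, LaurentPolynomial.T]
    simp
  · rintro ⟨r, s, t⟩ ⟨r', s', t'⟩ hne hle
    obtain ⟨P, hP, hs, hw⟩ := h r' s'
    simp only at hle
    simp only [hw, coeffAt, LinearMap.coe_mk, AddHom.coe_mk, wtVec, wt]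
    by_cases hd : (r' : ℤ) - s' = r - s
    · rw [← hd, Pi.single_eq_same, Polynomial.coeff_mul_C]
      rcases hle.eq_or_lt with rfl | hlt
      · obtain rfl : r' = r := by omega
        rw [← hs, hP.coeff_natDegree, one_mul]
        have ht : t' ≠ t := fun h ↦ hne (by rw [h])
        rw [LaurentPolynomial.T, AddMonoidAlgebra.coeff_single, Finsupp.single_eq_of_ne' ht]
      · rw [Polynomial.coeff_eq_zero_of_natDegree_lt (hs ▸ hlt), zero_mul]
        rfl
    · rw [Pi.single_eq_of_ne' hd]
      rfl

/-- Evaluation of operators at the generator of the zeroth weight space. -/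
noncomputable def evalVec : Op →ₗ[Cv] (ℤ → Coeff) where
  toFun x := x (wtVec 0 1)
  map_add' _ _ := rfl
  map_smul' _ _ := rfl

theorem linearIndependent_f_e :
    LinearIndependent Cv fun i : ℕ × ℕ × ℤ ↦
      opF ^ i.1 * opE ^ i.2.1 * ((opK ^ i.2.2 : Opˣ) : Op) := by
  refine LinearIndependent.of_comp evalVec (linearIndependent_of_monic fun r s ↦ ?_)
  obtain ⟨P, hP, hs, h⟩ := opE_pow_wtVec s 0
  refine ⟨P, hP, hs, fun t ↦ ?_⟩
  change (opF ^ r) ((opE ^ s) (((opK ^ t : Opˣ) : Op) (wtVec 0 1))) = _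
  rw [opK_zpow_wtVec, h, opF_pow_wtVec]
  congr 1
  ring

theorem linearIndependent_e_f :
    LinearIndependent Cv fun i : ℕ × ℕ × ℤ ↦
      opE ^ i.2.1 * opF ^ i.1 * ((opK ^ i.2.2 : Opˣ) : Op) := by
  refine LinearIndependent.of_comp evalVec (linearIndependent_of_monic fun r s ↦ ?_)
  obtain ⟨P, hP, hs, h⟩ := opE_pow_wtVec s r
  refine ⟨P, hP, hs, fun t ↦ ?_⟩
  change (opE ^ s) ((opF ^ r) (((opK ^ t : Opˣ) : Op) (wtVec 0 1))) = _
  rw [opK_zpow_wtVec, opF_pow_wtVec, zero_add, h]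

/-! ### Representations of `MU` -/

namespace MU

/-- The universal property of `MU`. -/
theorem exists_algHom {A : Type*} [Ring A] [Algebra Cv A] (e' f' l' : A) (k' : Aˣ)
    (hke : (k' : A) * e' = v ^ 2 • (e' * k')) (hkf : (k' : A) * f' = v⁻¹ ^ 2 • (f' * k'))
    (hef : e' * f' - f' * e' = (v - v⁻¹)⁻¹ • ((k' : A) - ((k'⁻¹ : Aˣ) : A)))
    (hl : l' * l' = l') (hkl : (k' : A) * l' = l' * k')
    (hle : l' * e' * l' = l' * e') (hlf : l' * f' * l' = f' * l')
    (hele : (v + v⁻¹) • (e' * l' * e') = v⁻¹ • (e' * e' * l') + v • (l' * (e' * e')))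
    (hflf : (v + v⁻¹) • (f' * l' * f') = v⁻¹ • (l' * (f' * f')) + v • (f' * f' * l')) :
    ∃ φ : MU →ₐ[Cv] A, φ e = e' ∧ φ f = f' ∧ φ l = l' ∧
      ∀ t : ℤ, φ (k ^ t : MUˣ) = (k' ^ t : Aˣ) := by
  let g : Gen → A := fun x ↦ match x with
    | .e => e' | .f => f' | .k => k' | .kInv => (k'⁻¹ : Aˣ) | .l => l'
  let F : Free →ₐ[Cv] A := FreeAlgebra.lift Cv g
  have he : F Free.e = e' := FreeAlgebra.lift_ι_apply g _
  have hf : F Free.f = f' := FreeAlgebra.lift_ι_apply g _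
  have hk : F Free.k = k' := FreeAlgebra.lift_ι_apply g _
  have hk' : F Free.kInv = (k'⁻¹ : Aˣ) := FreeAlgebra.lift_ι_apply g _
  have hl' : F Free.l = l' := FreeAlgebra.lift_ι_apply g _
  have hF : ∀ ⦃x y⦄, Rel x y → F x = F y := by
    rintro _ _ (_ | _) <;>
      simp only [map_mul, map_smul, map_add, map_sub, map_one, map_pow, he, hf, hk,
        hk', hl', qInt_two, Units.mul_inv, Units.inv_mul, pow_two e', pow_two f', pow_two l']
    · rw [hke, smul_mul_assoc, Units.mul_inv_cancel_right]
    · rw [hkf, smul_mul_assoc, Units.mul_inv_cancel_right]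
    all_goals assumption
  let φ : MU →ₐ[Cv] A := RingQuot.liftAlgHom Cv ⟨F, hF⟩
  have hφ : ∀ x, φ (mk x) = F x := fun x ↦ RingQuot.liftAlgHom_mkAlgHom_apply Cv F hF x
  refine ⟨φ, (hφ _).trans he, (hφ _).trans hf, (hφ _).trans hl', fun t ↦ ?_⟩
  have hu : Units.map (φ : MU →* A) k = k' := Units.ext ((hφ _).trans hk)
  rw [← hu, ← map_zpow]
  rfl

end MU

section Representations

variable {A : Type*} [Ring A] [Algebra Cv A]

/-- The unit `c • k`, for a nonzero scalar `c`. -/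
noncomputable def smulUnit {c : Cv} (hc : c ≠ 0) (k : Aˣ) : Aˣ where
  val := c • (k : A)
  inv := c⁻¹ • ((k⁻¹ : Aˣ) : A)
  val_inv := by rw [smul_mul_smul_comm, mul_inv_cancel₀ hc, Units.mul_inv, one_smul]
  inv_val := by rw [smul_mul_smul_comm, inv_mul_cancel₀ hc, Units.inv_mul, one_smul]

theorem smulUnit_val {c : Cv} (hc : c ≠ 0) (k : Aˣ) : (smulUnit hc k : A) = c • (k : A) := rfl

theorem smulUnit_inv_val {c : Cv} (hc : c ≠ 0) (k : Aˣ) :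
    (((smulUnit hc k)⁻¹ : Aˣ) : A) = c⁻¹ • ((k⁻¹ : Aˣ) : A) := rfl

theorem smulUnit_zpow {c : Cv} (hc : c ≠ 0) (k : Aˣ) (t : ℤ) :
    ((smulUnit hc k ^ t : Aˣ) : A) = c ^ t • ((k ^ t : Aˣ) : A) := by
  induction t using Int.induction_on with
  | zero => simp
  | succ i ih =>
    rw [zpow_add_one, Units.val_mul, ih, smulUnit_val, smul_mul_smul_comm, zpow_add_one,
      zpow_add_one₀ hc, Units.val_mul]
  | pred i ih =>
    rw [zpow_sub_one, Units.val_mul, ih, smulUnit_inv_val, smul_mul_smul_comm, zpow_sub_one,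
      zpow_sub_one₀ hc, Units.val_mul]

/-- A triple `(a, c, κ)` satisfying the quantum `sl₂` relations with `[a, c]` twisted to
`(κ - v⁻²κ⁻¹) / (v - v⁻¹)`, which is the form it takes on the first block of the matrix
representation, and for which the ordered monomials of both orders are linearly independent. -/
structure IsTwistedTriple (a c : A) (κ : Aˣ) : Prop where
  mul_a : (κ : A) * a = v ^ 2 • (a * κ)
  mul_c : (κ : A) * c = v⁻¹ ^ 2 • (c * κ)
  comm : a * c - c * a = (v - v⁻¹)⁻¹ • ((κ : A) - v⁻¹ ^ 2 • ((κ⁻¹ : Aˣ) : A))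
  linearIndependent_c_a : LinearIndependent Cv fun i : ℕ × ℕ × ℤ ↦
    c ^ i.1 * a ^ i.2.1 * ((κ ^ i.2.2 : Aˣ) : A)
  linearIndependent_a_c : LinearIndependent Cv fun i : ℕ × ℕ × ℤ ↦
    a ^ i.2.1 * c ^ i.1 * ((κ ^ i.2.2 : Aˣ) : A)

theorem isTwistedTriple_op : IsTwistedTriple opE opF opK :=
  ⟨opK_mul_opE, opK_mul_opF, opE_mul_opF, linearIndependent_f_e, linearIndependent_e_f⟩

namespace IsTwistedTriple

variable {a c : A} {κ : Aˣ}

theorem inv_mul_a (h : IsTwistedTriple a c κ) :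
    ((κ⁻¹ : Aˣ) : A) * a = v⁻¹ ^ 2 • (a * (κ⁻¹ : Aˣ)) := by
  simpa using zpow_mul_of_mul (pow_ne_zero 2 v_ne_zero) h.mul_a (-1)

theorem inv_mul_c (h : IsTwistedTriple a c κ) :
    ((κ⁻¹ : Aˣ) : A) * c = v ^ 2 • (c * (κ⁻¹ : Aˣ)) := by
  simpa using zpow_mul_of_mul (pow_ne_zero 2 (inv_ne_zero v_ne_zero)) h.mul_c (-1)

/-- Rescaling removes the twist: `(v • a, c, v • κ)` satisfies the relations of quantum `sl₂`, and
these extend to `MU` with `l` acting as `0` or as `1`. -/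
theorem exists_scalar_rep (h : IsTwistedTriple a c κ) (l' : A) (hl : l' = 0 ∨ l' = 1) :
    ∃ φ : MU →ₐ[Cv] A, φ MU.e = v • a ∧ φ MU.f = c ∧ φ MU.l = l' ∧
      ∀ t : ℤ, φ (MU.k ^ t : MUˣ) = v ^ t • ((κ ^ t : Aˣ) : A) := by
  have hlx : ∀ x, l' * x = x * l' := by rcases hl with rfl | rfl <;> simp
  have hll : l' * l' = l' := by rcases hl with rfl | rfl <;> simp
  obtain ⟨φ, he, hf, hl', hk⟩ := MU.exists_algHom (v • a) c l' (smulUnit v_ne_zero κ)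
    (by rw [smulUnit_val, smul_mul_smul_comm, h.mul_a, smul_mul_smul_comm, smul_comm])
    (by rw [smulUnit_val, smul_mul_assoc, h.mul_c, mul_smul_comm, smul_comm])
    (by rw [smulUnit_val, smulUnit_inv_val, smul_mul_assoc, mul_smul_comm, ← smul_sub, h.comm,
      smul_comm v, smul_sub v, smul_smul v (v⁻¹ ^ 2), pow_two, mul_inv_cancel_left₀ v_ne_zero])
    hll (hlx _).symm (by rw [mul_assoc, ← hlx, ← mul_assoc, hll])
    (by rw [hlx, mul_assoc, hll])
    (by rw [mul_assoc, hlx, hlx, ← mul_assoc, add_smul, add_comm])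
    (by rw [mul_assoc, hlx, hlx, ← mul_assoc, add_smul, add_comm])
  exact ⟨φ, he, hf, hl', fun t ↦ by rw [hk, smulUnit_zpow]⟩

end IsTwistedTriple

/-- The diagonal unit `diag(κ, v²κ)`, the image of `k`; the factor `v²` is the weight of the
off-diagonal entry `1` of `e`. -/
noncomputable def diagUnit (κ : Aˣ) : (Matrix (Fin 2) (Fin 2) A)ˣ where
  val := !![(κ : A), 0; 0, v ^ 2 • (κ : A)]
  inv := !![((κ⁻¹ : Aˣ) : A), 0; 0, v⁻¹ ^ 2 • ((κ⁻¹ : Aˣ) : A)]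
  val_inv := by simp [Matrix.one_fin_two, smul_smul, v_ne_zero]
  inv_val := by simp [Matrix.one_fin_two, smul_smul, v_ne_zero]

theorem diagUnit_val (κ : Aˣ) :
    (diagUnit κ : Matrix (Fin 2) (Fin 2) A) = !![(κ : A), 0; 0, v ^ 2 • (κ : A)] := rfl

theorem diagUnit_inv_val (κ : Aˣ) : (((diagUnit κ)⁻¹ : (Matrix (Fin 2) (Fin 2) A)ˣ) :
    Matrix (Fin 2) (Fin 2) A) =
      !![((κ⁻¹ : Aˣ) : A), 0; 0, v⁻¹ ^ 2 • ((κ⁻¹ : Aˣ) : A)] := rfl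

theorem diagUnit_zpow (κ : Aˣ) (t : ℤ) :
    ((diagUnit κ ^ t : (Matrix (Fin 2) (Fin 2) A)ˣ) : Matrix (Fin 2) (Fin 2) A) =
      !![((κ ^ t : Aˣ) : A), 0; 0, (v ^ 2) ^ t • ((κ ^ t : Aˣ) : A)] := by
  have hv : v ^ 2 ≠ 0 := pow_ne_zero 2 v_ne_zero
  induction t using Int.induction_on with
  | zero => simp [Matrix.one_fin_two]
  | succ i ih =>
    rw [zpow_add_one, Units.val_mul, ih, diagUnit_val, Matrix.mul_fin_two, zpow_add_one,
      zpow_add_one₀ hv]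
    simp [smul_smul, mul_comm]
  | pred i ih =>
    rw [zpow_sub_one, Units.val_mul, ih, diagUnit_inv_val, Matrix.mul_fin_two, zpow_sub_one,
      zpow_sub_one₀ hv]
    simp [smul_smul, mul_comm]

/-- The image of `e` in the matrix representation. -/
noncomputable def matE (a : A) : Matrix (Fin 2) (Fin 2) A := !![a, 0; 1, v ^ 2 • a]

/-- The image of `f` in the matrix representation. -/
noncomputable def matF (c : A) (κ : Aˣ) : Matrix (Fin 2) (Fin 2) A :=
  !![c, v⁻¹ • ((κ⁻¹ : Aˣ) : A); 0, c]

/-- The image of `l` in the matrix representation. -/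
def matL : Matrix (Fin 2) (Fin 2) A := !![1, 0; 0, 0]

/-- The scalar identity which makes the correction `v⁻¹κ⁻¹` from the off-diagonal block untwist
`[a, c]`. -/
theorem scalar_identity : (v - v⁻¹)⁻¹ * v⁻¹ ^ 2 + v⁻¹ = (v - v⁻¹)⁻¹ := by
  have h := v_sub_inv_ne_zero
  have h2 : v * v⁻¹ = 1 := mul_inv_cancel₀ v_ne_zero
  have h3 : (v - v⁻¹)⁻¹ * (v - v⁻¹) = 1 := inv_mul_cancel₀ h
  generalize (v - v⁻¹)⁻¹ = d at *
  generalize v⁻¹ = w at *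
  linear_combination d * h2 - w * h3

namespace IsTwistedTriple

variable {a c : A} {κ : Aˣ}

theorem matE_mul_matF (h : IsTwistedTriple a c κ) :
    matE a * matF c κ - matF c κ * matE a =
      (v - v⁻¹)⁻¹ • ((diagUnit κ : Matrix (Fin 2) (Fin 2) A) -
        (((diagUnit κ)⁻¹ : (Matrix (Fin 2) (Fin 2) A)ˣ) : Matrix (Fin 2) (Fin 2) A)) := by
  have hac := eq_add_of_sub_eq' h.comm
  have hs := scalar_identity
  have h00 : a * c - (c * a + v⁻¹ • ((κ⁻¹ : Aˣ) : A)) =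
      (v - v⁻¹)⁻¹ • ((κ : A) - ((κ⁻¹ : Aˣ) : A)) := by
    rw [hac, smul_sub, smul_sub, smul_smul]
    nth_rewrite 4 [← hs]
    rw [add_smul]
    abel
  have h11 : v⁻¹ • ((κ⁻¹ : Aˣ) : A) + v ^ 2 • (a * c) - v ^ 2 • (c * a) =
      (v - v⁻¹)⁻¹ • (v ^ 2 • (κ : A) - v⁻¹ ^ 2 • ((κ⁻¹ : Aˣ) : A)) := by
    have h1 : v ^ 2 * ((v - v⁻¹)⁻¹ * v⁻¹ ^ 2) = (v - v⁻¹)⁻¹ := by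
      rw [mul_left_comm, ← mul_pow, mul_inv_cancel₀ v_ne_zero, one_pow, mul_one]
    rw [hac, smul_add, smul_sub, smul_sub, smul_sub, smul_smul, smul_smul, smul_smul, smul_smul,
      mul_assoc, h1, smul_smul, mul_comm (v ^ 2)]
    nth_rewrite 2 [← hs]
    rw [add_smul]
    abel
  have h01 : a * ((κ⁻¹ : Aˣ) : A) = v ^ 2 • (((κ⁻¹ : Aˣ) : A) * a) := by
    rw [h.inv_mul_a, smul_smul, ← mul_pow, mul_inv_cancel₀ v_ne_zero, one_pow, one_smul]
  rw [diagUnit_val, diagUnit_inv_val]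
  ext i j
  fin_cases i <;> fin_cases j
  · simpa [matE, matF] using h00
  · simp [matE, matF, h01, smul_comm v⁻¹]
  · simp [matE, matF]
  · simpa [matE, matF] using h11

/-- The representation in which `l` is the idempotent of the first block. The `2 × 2` matrices
realise the Peirce decomposition of `MU` with respect to `l`. -/
theorem exists_matrix_rep (h : IsTwistedTriple a c κ) :
    ∃ φ : MU →ₐ[Cv] Matrix (Fin 2) (Fin 2) A, φ MU.e = matE a ∧ φ MU.f = matF c κ ∧
      φ MU.l = matL ∧
      ∀ t : ℤ, φ (MU.k ^ t : MUˣ) = (diagUnit κ ^ t : (Matrix (Fin 2) (Fin 2) A)ˣ) := by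
  have hv := v_ne_zero
  refine MU.exists_algHom (matE a) (matF c κ) matL (diagUnit κ) ?_ ?_ h.matE_mul_matF ?_ ?_ ?_ ?_
    ?_ ?_
  all_goals ext i j; fin_cases i <;> fin_cases j
  all_goals simp [matE, matF, matL, diagUnit_val, h.mul_a, h.mul_c, h.inv_mul_c, smul_smul,
    add_smul]
  all_goals try simp only [← add_smul]
  all_goals congr 1; try field_simp
  all_goals ring

end IsTwistedTriple

end Representations

/-! ### Linear independence of the monomials -/

section Independence

variable {A : Type*} [Ring A] [Algebra Cv A]

/-- The lower left entry of a power of the matrix of `e`. -/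
noncomputable def offE (a : A) : ℕ → A
  | 0 => 0
  | s + 1 => (∑ i ∈ Finset.range (s + 1), (v ^ 2) ^ i) • a ^ s

/-- The upper right entry of a power of the matrix of `f`. -/
noncomputable def offF (c : A) (κ : Aˣ) : ℕ → A
  | 0 => 0
  | r + 1 => (v⁻¹ * ∑ i ∈ Finset.range (r + 1), (v ^ 2) ^ i) • (c ^ r * ((κ⁻¹ : Aˣ) : A))

theorem offE_zero (a : A) : offE a 0 = 0 := rfl

theorem offF_zero (c : A) (κ : Aˣ) : offF c κ 0 = 0 := rfl

theorem matE_pow (a : A) (s : ℕ) :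
    matE a ^ s = !![a ^ s, 0; offE a s, (v ^ 2) ^ s • a ^ s] := by
  induction s with
  | zero => simp [offE, Matrix.one_fin_two]
  | succ s ih =>
    rw [pow_succ', ih, matE, Matrix.mul_fin_two]
    have h : a ^ s + v ^ 2 • (a * offE a s) = offE a (s + 1) := by
      cases s with
      | zero => simp [offE]
      | succ s =>
        rw [offE, offE, geom_sum_succ (n := s + 1), mul_smul_comm, ← pow_succ', smul_smul,
          add_smul, one_smul, add_comm]
    simp [h, pow_succ' a, pow_succ (v ^ 2), smul_smul]

theorem IsTwistedTriple.matF_pow {a c : A} {κ : Aˣ} (h : IsTwistedTriple a c κ) (r : ℕ) :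
    matF c κ ^ r = !![c ^ r, offF c κ r; 0, c ^ r] := by
  induction r with
  | zero => simp [offF, Matrix.one_fin_two]
  | succ r ih =>
    rw [pow_succ', ih, matF, Matrix.mul_fin_two]
    have h1 : c * offF c κ r + v⁻¹ • (((κ⁻¹ : Aˣ) : A) * c ^ r) = offF c κ (r + 1) := by
      rw [mul_pow_of_mul h.inv_mul_c]
      cases r with
      | zero => simp [offF]
      | succ r =>
        rw [offF, offF, Finset.sum_range_succ _ (r + 1), mul_smul_comm, ← mul_assoc, ← pow_succ',
          smul_smul, ← add_smul, mul_add]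
    simp [h1, pow_succ']

theorem exists_linearMap_of_linearIndependent {ι V W : Type*} [AddCommGroup V] [Module Cv V]
    [AddCommGroup W] [Module Cv W] {x : ι → V} (hx : LinearIndependent Cv x) (y : ι → W) :
    ∃ D : V →ₗ[Cv] W, ∀ i, D (x i) = y i := by
  obtain ⟨D, hD⟩ := ((Module.Basis.span hx).constr Cv y).exists_extend
  refine ⟨D, fun i ↦ ?_⟩
  have h := LinearMap.congr_fun hD (Module.Basis.span hx i)
  rw [Module.Basis.constr_basis] at h
  simpa [Module.Basis.span_apply] using h

/-- Elimination step: if a linear map sends the monomials `pbw (j y)` to nonzero multiples of a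
linearly independent family and kills all others whose coefficient is not already known to vanish,
then the coefficients at `j y` vanish. -/
theorem coeff_eq_zero {V J : Type*} [AddCommGroup V] [Module Cv V] {x : PBWIndex →₀ Cv}
    (hx : Finsupp.linearCombination Cv pbw x = 0) (Φ : MU →ₗ[Cv] V) (j : J → PBWIndex) {w : J → V}
    (hw : LinearIndependent Cv w) (hΦ : ∀ y, ∃ b : Cv, b ≠ 0 ∧ Φ (pbw (j y)) = b • w y)
    (h₀ : ∀ i, i ∈ Set.range j ∨ x i = 0 ∨ Φ (pbw i) = 0) (y : J) : x (j y) = 0 := by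
  choose b hb hΦ using hΦ
  have hw' : LinearIndependent Cv fun y ↦ Φ (pbw (j y)) := by
    have h := hw.units_smul fun y ↦ Units.mk0 (b y) (hb y)
    convert h using 2 with y
    rw [hΦ]
    rfl
  have hj : Function.Injective j := fun y z h ↦ hw'.injective (by simp only [h])
  have hsum : ∑ i ∈ x.support, x i • Φ (pbw i) = 0 := by
    have h := congrArg Φ hx
    rw [Finsupp.linearCombination_apply, map_finsuppSum, map_zero, Finsupp.sum] at h
    simpa only [map_smul] using h
  rw [← Finset.sum_preimage j x.support hj.injOn] at hsum
  · by_contra hy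
    exact hy (linearIndependent_iff'.mp hw' _ (fun y ↦ x (j y)) hsum y (by simpa using hy))
  · intro i _ hi
    rcases h₀ i with h | h | h
    · exact absurd h hi
    · rw [h, zero_smul]
    · rw [h, smul_zero]

/-- The representations `φ₀`, `φ₁` (with `l` acting as `0`, `1`) and the blocks of the matrix
representation `φ` are applied one after the other; each removes one family of monomials. -/
theorem IsTwistedTriple.linearIndependent_pbw {a c : A} {κ : Aˣ} (h : IsTwistedTriple a c κ) :
    LinearIndependent Cv pbw := by
  have hv := v_ne_zero
  have hσ := geom_sum_ne_zero v_sq_pow_ne_one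
  obtain ⟨φ₀, he₀, hf₀, hl₀, hk₀⟩ := h.exists_scalar_rep 0 (Or.inl rfl)
  obtain ⟨φ₁, he₁, hf₁, hl₁, hk₁⟩ := h.exists_scalar_rep 1 (Or.inr rfl)
  obtain ⟨φ, he, hf, hl, hk⟩ := h.exists_matrix_rep
  have hca := h.linearIndependent_c_a
  have hkk : ∀ t : ℤ, ((κ⁻¹ : Aˣ) : A) * ((κ ^ (t + 1) : Aˣ) : A) = (κ ^ t : Aˣ) := fun t ↦ by
    rw [← Units.val_mul, zpow_add_one, (Commute.zpow_self κ t).eq, inv_mul_cancel_left]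
  have hκa : ∀ s : ℕ, ∀ u : A, ((κ⁻¹ : Aˣ) : A) * (a ^ s * u) =
      (v⁻¹ ^ 2) ^ s • (a ^ s * (((κ⁻¹ : Aˣ) : A) * u)) := fun s u ↦ by
    rw [← mul_assoc, mul_pow_of_mul h.inv_mul_a, smul_mul_assoc, mul_assoc]
  rw [linearIndependent_iff]
  intro x hx
  let entry (i j : Fin 2) : MU →ₗ[Cv] A := Matrix.entryLinearMap Cv A i j ∘ₗ φ.toLinearMap
  have hentry : ∀ i j u, entry i j u = φ u i j := fun _ _ _ ↦ rfl
  have z₀ : ∀ r s t, x (.B₀ r s t) = 0 := by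
    refine fun r s t ↦ coeff_eq_zero hx φ₀.toLinearMap
      (fun y : ℕ × ℕ × ℤ ↦ .B₀ y.1 y.2.1 y.2.2) hca ?_ ?_ (r, s, t)
    · rintro ⟨r, s, t⟩
      refine ⟨v ^ s * v ^ t, mul_ne_zero (pow_ne_zero _ hv) (zpow_ne_zero _ hv), ?_⟩
      simp [pbw, he₀, hf₀, hk₀, smul_pow, smul_smul, mul_comm]
    · rintro (_ | _ | _ | _ | _ | _)
      · exact Or.inl ⟨(_, _, _), rfl⟩
      all_goals right; right; simp [pbw, hl₀]
  -- Among the remaining monomials only `B₅` has a component in the second diagonal block. The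
  -- index shift `t + 1` absorbs the `κ⁻¹` contributed by the off-diagonal block of `f`.
  have z₅ : ∀ r s t, x (.B₅ (r + 1) (s + 1) t (by omega) (by omega)) = 0 := by
    intro r s t
    have := coeff_eq_zero hx (entry 1 1)
      (fun y : ℕ × ℕ × ℤ ↦ .B₅ (y.1 + 1) (y.2.1 + 1) (y.2.2 + 1) (by omega) (by omega))
      h.linearIndependent_a_c ?_ ?_ (r, s, t - 1)
    · simpa using this
    · rintro ⟨r, s, t⟩
      refine ⟨_, mul_ne_zero (zpow_ne_zero (t + 1) (pow_ne_zero 2 hv))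
        (mul_ne_zero (hσ s) (mul_ne_zero (inv_ne_zero hv) (hσ r))), ?_⟩
      simp only [hentry, pbw, map_mul, map_pow, he, hf, hl, hk, matE_pow, h.matF_pow, diagUnit_zpow,
        matL, offE, offF]
      simp [smul_smul, mul_assoc, hkk]
      congr 1
      ring
    · rintro (_ | _ | _ | _ | _ | ⟨r, s, t, hr, hs⟩)
      · exact Or.inr (Or.inl (z₀ _ _ _))
      on_goal 5 =>
        obtain ⟨r, rfl⟩ := Nat.exists_eq_add_of_le' hr
        obtain ⟨s, rfl⟩ := Nat.exists_eq_add_of_le' hs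
        exact Or.inl ⟨(r, s, t - 1), by simp⟩
      all_goals right; right
      all_goals simp only [hentry, pbw, map_mul, map_pow, he, hf, hl, hk, matE_pow, h.matF_pow,
        diagUnit_zpow, matL]
      all_goals simp
  have z₁ : ∀ r s t, x (.B₁ (r + 1) s t) = 0 := by
    intro r s t
    have := coeff_eq_zero hx (entry 0 1)
      (fun y : ℕ × ℕ × ℤ ↦ .B₁ (y.1 + 1) y.2.1 (y.2.2 + 1)) hca ?_ ?_ (r, s, t - 1)
    · simpa using this
    · rintro ⟨r, s, t⟩
      refine ⟨_, mul_ne_zero (mul_ne_zero (zpow_ne_zero (t + 1) (pow_ne_zero 2 hv))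
        (pow_ne_zero s (pow_ne_zero 2 hv))) (mul_ne_zero (mul_ne_zero (inv_ne_zero hv) (hσ r))
          (pow_ne_zero s (pow_ne_zero 2 (inv_ne_zero hv)))), ?_⟩
      simp only [hentry, pbw, map_mul, map_pow, he, hf, hl, hk, matE_pow, h.matF_pow, diagUnit_zpow,
        matL, offF]
      simp only [Matrix.mul_fin_two]
      simp [smul_smul, mul_assoc, hκa, hkk]
    · rintro (_ | ⟨_ | r, s, t⟩ | _ | _ | _ | ⟨r, s, t, hr, hs⟩)
      · exact Or.inr (Or.inl (z₀ _ _ _))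
      on_goal 2 => exact Or.inl ⟨(r, s, t - 1), by simp⟩
      on_goal 5 =>
        obtain ⟨r, rfl⟩ := Nat.exists_eq_add_of_le' hr
        obtain ⟨s, rfl⟩ := Nat.exists_eq_add_of_le' hs
        exact Or.inr (Or.inl (z₅ _ _ _))
      all_goals right; right
      all_goals simp only [hentry, pbw, map_mul, map_pow, he, hf, hl, hk, matE_pow, h.matF_pow,
        diagUnit_zpow, matL]
      all_goals simp [offF_zero]
  have z₂ : ∀ r s t, x (.B₂ r (s + 1) t (by simp)) = 0 := by
    intro r s t
    refine coeff_eq_zero hx (entry 1 0)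
      (fun y : ℕ × ℕ × ℤ ↦ .B₂ y.1 (y.2.1 + 1) y.2.2 (by simp)) hca ?_ ?_ (r, s, t)
    · rintro ⟨r, s, t⟩
      refine ⟨_, hσ s, ?_⟩
      simp only [hentry, pbw, map_mul, map_pow, he, hf, hl, hk, matE_pow, h.matF_pow, diagUnit_zpow,
        matL, offE]
      simp [mul_assoc]
    · rintro (_ | _ | ⟨r, _ | s, t⟩ | _ | _ | ⟨r, s, t, hr, hs⟩)
      · exact Or.inr (Or.inl (z₀ _ _ _))
      on_goal 3 => exact Or.inl ⟨(r, s, t), rfl⟩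
      on_goal 5 =>
        obtain ⟨r, rfl⟩ := Nat.exists_eq_add_of_le' hr
        obtain ⟨s, rfl⟩ := Nat.exists_eq_add_of_le' hs
        exact Or.inr (Or.inl (z₅ _ _ _))
      all_goals right; right
      all_goals simp only [hentry, pbw, map_mul, map_pow, he, hf, hl, hk, matE_pow, h.matF_pow,
        diagUnit_zpow, matL]
      all_goals simp [offE_zero]
  -- The monomials of `B₃` and `B₄` have the same image under `φ₁`. The map `D` carries the
  -- `φ₁`-image of `fʳeˢkᵗ` to `cʳaˢκᵗ`, so that `entry 0 0 - D ∘ φ₁` kills `B₄` and retains from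
  -- `B₃` exactly the summand that passes through the second block.
  obtain ⟨D, hD⟩ := exists_linearMap_of_linearIndependent hca
    fun i ↦ (v ^ i.2.2 * v ^ i.2.1)⁻¹ • (c ^ i.1 * a ^ i.2.1 * ((κ ^ i.2.2 : Aˣ) : A))
  have hφ₁ : ∀ (r s : ℕ) (t : ℤ), φ₁ (MU.f ^ r * MU.e ^ s * (MU.k ^ t : MUˣ)) =
      (v ^ t * v ^ s) • (c ^ r * a ^ s * ((κ ^ t : Aˣ) : A)) := fun r s t ↦ by
    simp [he₁, hf₁, hk₁, smul_pow, smul_smul]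
  have hD' : ∀ (r s : ℕ) (t : ℤ), D (φ₁ (MU.f ^ r * MU.e ^ s * (MU.k ^ t : MUˣ))) =
      c ^ r * a ^ s * ((κ ^ t : Aˣ) : A) := fun r s t ↦ by
    rw [hφ₁, map_smul, hD (r, s, t),
      smul_inv_smul₀ (mul_ne_zero (zpow_ne_zero t hv) (pow_ne_zero s hv))]
  have h₁ : ∀ r s t, φ₁ (pbw (.B₁ r s t)) = φ₁ (MU.f ^ r * MU.e ^ s * (MU.k ^ t : MUˣ)) :=
    fun r s t ↦ by simp [pbw, hl₁]
  have h₂ : ∀ r s t hrs, φ₁ (pbw (.B₂ r s t hrs)) =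
      φ₁ (MU.f ^ r * MU.e ^ s * (MU.k ^ t : MUˣ)) := fun r s t hrs ↦ by simp [pbw, hl₁]
  have h₃ : ∀ r s t hr hs, φ₁ (pbw (.B₃ r s t hr hs)) =
      φ₁ (MU.f ^ r * MU.e ^ s * (MU.k ^ t : MUˣ)) := fun r s t hr hs ↦ by simp [pbw, hl₁]
  have h₄ : ∀ r s t hr hs, φ₁ (pbw (.B₄ r s t hr hs)) =
      φ₁ (MU.f ^ r * MU.e ^ s * (MU.k ^ t : MUˣ)) := fun r s t hr hs ↦ by simp [pbw, hl₁]
  have hΨ : ∀ u, (entry 0 0 - D ∘ₗ φ₁.toLinearMap) u = φ u 0 0 - D (φ₁ u) := fun _ ↦ rfl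
  have z₃ : ∀ r s t, x (.B₃ (r + 1) (s + 1) t (by omega) (by omega)) = 0 := by
    intro r s t
    have := coeff_eq_zero hx (entry 0 0 - D ∘ₗ φ₁.toLinearMap)
      (fun y : ℕ × ℕ × ℤ ↦ .B₃ (y.1 + 1) (y.2.1 + 1) (y.2.2 + 1) (by omega) (by omega)) hca ?_ ?_
      (r, s, t - 1)
    · simpa using this
    · rintro ⟨r, s, t⟩
      refine ⟨_, mul_ne_zero (mul_ne_zero (hσ s) (pow_ne_zero s (pow_ne_zero 2 (inv_ne_zero hv))))
        (mul_ne_zero (inv_ne_zero hv) (hσ r)), ?_⟩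
      rw [hΨ, h₃, hD']
      simp only [pbw, map_mul, map_pow, he, hf, hl, hk, matE_pow, h.matF_pow, diagUnit_zpow,
        matL, offE, offF]
      simp [smul_smul, mul_assoc, hκa, hkk, add_mul]
      congr 1
      ring
    · rintro (_ | ⟨_ | r, s, t⟩ | ⟨r, _ | s, t⟩ | ⟨r, s, t, hr, hs⟩ | _ | ⟨r, s, t, hr, hs⟩)
      · exact Or.inr (Or.inl (z₀ _ _ _))
      on_goal 2 => exact Or.inr (Or.inl (z₁ _ _ _))
      on_goal 3 => exact Or.inr (Or.inl (z₂ _ _ _))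
      on_goal 3 =>
        obtain ⟨r, rfl⟩ := Nat.exists_eq_add_of_le' hr
        obtain ⟨s, rfl⟩ := Nat.exists_eq_add_of_le' hs
        exact Or.inl ⟨(r, s, t - 1), by simp⟩
      on_goal 4 =>
        obtain ⟨r, rfl⟩ := Nat.exists_eq_add_of_le' hr
        obtain ⟨s, rfl⟩ := Nat.exists_eq_add_of_le' hs
        exact Or.inr (Or.inl (z₅ _ _ _))
      all_goals right; right
      on_goal 1 => rw [hΨ, h₁, hD']
      on_goal 2 => rw [hΨ, h₂, hD']
      on_goal 3 => rw [hΨ, h₄, hD']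
      all_goals simp only [pbw, map_mul, map_pow, he, hf, hl, hk, matE_pow, h.matF_pow,
        diagUnit_zpow, matL]
      all_goals simp [offE_zero, offF_zero]
  let j : ℕ × ℕ × ℤ → PBWIndex := fun y ↦ match y with
    | (0, s, t) => .B₁ 0 s t
    | (r + 1, 0, t) => .B₂ (r + 1) 0 t (by simp)
    | (r + 1, s + 1, t) => .B₄ (r + 1) (s + 1) t (by omega) (by omega)
  have z : ∀ y, x (j y) = 0 := by
    refine coeff_eq_zero hx φ₁.toLinearMap j hca ?_ ?_
    · rintro ⟨r, s, t⟩
      refine ⟨v ^ t * v ^ s, mul_ne_zero (zpow_ne_zero t hv) (pow_ne_zero s hv), ?_⟩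
      refine Eq.trans ?_ (hφ₁ r s t)
      match r, s with
      | 0, s => exact h₁ _ _ _
      | r + 1, 0 => exact h₂ _ _ _ _
      | r + 1, s + 1 => exact h₄ _ _ _ _ _
    · rintro (_ | ⟨_ | r, s, t⟩ | ⟨_ | r, _ | s, t, hrs⟩ | ⟨r, s, t, hr, hs⟩ | ⟨r, s, t, hr, hs⟩ |
        ⟨r, s, t, hr, hs⟩)
      · exact Or.inr (Or.inl (z₀ _ _ _))
      · exact Or.inl ⟨(0, s, t), rfl⟩
      · exact Or.inr (Or.inl (z₁ _ _ _))
      · exact absurd rfl hrs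
      · exact Or.inr (Or.inl (z₂ _ _ _))
      · exact Or.inl ⟨(r + 1, 0, t), rfl⟩
      · exact Or.inr (Or.inl (z₂ _ _ _))
      all_goals
        obtain ⟨r, rfl⟩ := Nat.exists_eq_add_of_le' hr
        obtain ⟨s, rfl⟩ := Nat.exists_eq_add_of_le' hs
      · exact Or.inr (Or.inl (z₃ _ _ _))
      · exact Or.inl ⟨(r + 1, s + 1, t), rfl⟩
      · exact Or.inr (Or.inl (z₅ _ _ _))
  ext i
  rw [Finsupp.zero_apply]
  rcases i with _ | ⟨_ | r, s, t⟩ | ⟨_ | r, _ | s, t, hrs⟩ | ⟨r, s, t, hr, hs⟩ |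
    ⟨r, s, t, hr, hs⟩ | ⟨r, s, t, hr, hs⟩
  · exact z₀ _ _ _
  · exact z (0, s, t)
  · exact z₁ _ _ _
  · exact absurd rfl hrs
  · exact z₂ _ _ _
  · exact z (r + 1, 0, t)
  · exact z₂ _ _ _
  all_goals
    obtain ⟨r, rfl⟩ := Nat.exists_eq_add_of_le' hr
    obtain ⟨s, rfl⟩ := Nat.exists_eq_add_of_le' hs
  · exact z₃ _ _ _
  · exact z (r + 1, s + 1, t)
  · exact z₅ _ _ _

end Independence

end MirabolicSl2

theorem mainTheorem3 :
    LinearIndependent MirabolicSl2.Cv MirabolicSl2.pbw ∧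
      Submodule.span MirabolicSl2.Cv (Set.range MirabolicSl2.pbw) = ⊤ :=
  ⟨MirabolicSl2.isTwistedTriple_op.linearIndependent_pbw, MirabolicSl2.MU.pbwSpan_eq_top⟩
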